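/- Let $d_A,d_B\ge 2$, $d=d_Ad_B$, and let $\rho_{AB}$ be any density matrix on $\mathbb{C}^{d_A}\otimes\mathbb{C}^{d_B}$. Let $\mu$ be the Haar probability measure on the unitary group $U(d)$. For $U\in U(d)$ write $\rho'=U\rho_{AB}U^\dagger$, with reduced states $\rho'_A=\mathrm{Tr}_B\,\rho'$ and $\rho'_B=\mathrm{Tr}_A\,\rho'$. Let $S(\rho)=-\mathrm{Tr}(\rho\ln\rho)$ be the von Neumann entropy, $S(\rho\|\sigma)=\mathrm{Tr}(\rho(\ln\rho-\ln\sigma))$ the relative entropy, $I(A:B)_{\rho'}=S(\rho'\|\rho'_A\otimes\rho'_B)$ the mutual information, and $$\langle S_A+S_B\rangle=\int S(\rho'_A)\,d\mu(U)+\int S(\rho'_B)\,d\mu(U).$$ Put $\sigma=c_0\mathbb{1}_d+c_1\rho_{AB}+c_2\rho_{AB}^2$, where $$c_0=\frac{(d_A^2-1)(d_B^2-1)}{(d^2-1)(d^2-4)}\bigl(d-2\,\mathrm{Tr}\,\rho_{AB}^2\bigr),\quad c_1=\frac{d^2(d_A^2+d_B^2-6)+4}{(d^2-1)(d^2-4)},\quad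 c_2=\frac{2d(d_A^2-1)(d_B^2-1)}{(d^2-1)(d^2-4)}.$$ Then all the entropies, relative entropies and integrals below are well defined and finite ($\sigma$ is positive definite, the support of $\rho'$ lies in that of $\rho'_A\otimes\rho'_B$ for every $U$, and the integrands are integrable), and $$S(\rho_{AB})+S(\rho_{AB}\|\sigma)\le\langle S_A+S_B\rangle\le S(\sigma),$$ $$S(\rho_{AB}\|\sigma)\le\int I(A:B)_{\rho'}\,d\mu(U)\le S(\sigma)-S(\rho_{AB}).$$ In particular, $S(\rho_{AB}\|\sigma)\le S(\sigma)-S(\rho_{AB})$ for every such $\rho_{AB}$. Moreover, $\rho_{AB}=\sigma$ if and only if $\rho_{AB}$ is maximally mixed, i.e. $\rho_{AB}=\frac{\mathbb{1}_A}{d_A}\otimes\frac{\mathbb{1}_B}{d_B}$. -/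

import Mathlib

open Matrix MeasureTheory
open scoped Kronecker ComplexOrder

/-- Density matrices (quantum states): positive semidefinite complex matrices of trace one. -/
def IsDensityMatrix {n : Type*} [Fintype n] (ρ : Matrix n n ℂ) : Prop :=
  ρ.PosSemidef ∧ ρ.trace = 1

/-- The reduced state `ρ_A = Tr_B ρ` of a matrix on `ℂ^a ⊗ ℂ^b = ℂ^(a × b)`. -/
def reducedA {a b : Type*} [Fintype b] (ρ : Matrix (a × b) (a × b) ℂ) : Matrix a a ℂ :=
  Matrix.of fun i k => ∑ j, ρ (i, j) (k, j)

/-- The reduced state `ρ_B = Tr_A ρ` of a matrix on `ℂ^a ⊗ ℂ^b = ℂ^(a × b)`. -/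
def reducedB {a b : Type*} [Fintype a] (ρ : Matrix (a × b) (a × b) ℂ) : Matrix b b ℂ :=
  Matrix.of fun j l => ∑ i, ρ (i, j) (i, l)

/-- The logarithm of a Hermitian matrix, by functional calculus (natural logarithm of the
eigenvalues). Zero eigenvalues are sent to `0`, which realizes `0 ln 0 = 0` in the entropies. -/
noncomputable def matLog {n : Type*} [Fintype n] [DecidableEq n] (ρ : Matrix n n ℂ) :
    Matrix n n ℂ :=
  cfc Real.log ρ

/-- The von Neumann entropy `S(ρ) = - Tr (ρ ln ρ)`. -/
noncomputable def vnEntropy {n : Type*} [Fintype n] [DecidableEq n] (ρ : Matrix n n ℂ) : ℝ :=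
  -(ρ * matLog ρ).trace.re

/-- The support of `ρ` lies in the support of `σ` (for Hermitian matrices: `ker σ ⊆ ker ρ`).
Exactly in this case the relative entropy of `ρ` with respect to `σ` is finite. -/
def SupportLE {n : Type*} [Fintype n] (ρ σ : Matrix n n ℂ) : Prop :=
  ∀ v : n → ℂ, σ *ᵥ v = 0 → ρ *ᵥ v = 0

/-- The relative entropy `S(ρ‖σ) = Tr (ρ (ln ρ - ln σ))`, for states with `SupportLE ρ σ`. -/
noncomputable def relEntropy {n : Type*} [Fintype n] [DecidableEq n] (ρ σ : Matrix n n ℂ) : ℝ :=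
  (ρ * (matLog ρ - matLog σ)).trace.re

/-- The quantum mutual information `I(A:B)_ρ = S(ρ_AB ‖ ρ_A ⊗ ρ_B)`. -/
noncomputable def mutualInfo {a b : Type*} [Fintype a] [DecidableEq a] [Fintype b]
    [DecidableEq b] (ρ : Matrix (a × b) (a × b) ℂ) : ℝ :=
  relEntropy ρ (reducedA ρ ⊗ₖ reducedB ρ)

/-- The point `U ρ U†` of the unitary orbit of `ρ`. -/
def orbitState {n : Type*} [Fintype n] [DecidableEq n] (ρ : Matrix n n ℂ)
    (U : unitaryGroup n ℂ) : Matrix n n ℂ :=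
  (U : Matrix n n ℂ) * ρ * (U : Matrix n n ℂ)ᴴ

/-- The coefficient `c₀`, as a function of `d_A`, `d_B` and the purity `p = Tr ρ²`. -/
noncomputable def coeff0 (dA dB p : ℝ) : ℝ :=
  (dA ^ 2 - 1) * (dB ^ 2 - 1) / (((dA * dB) ^ 2 - 1) * ((dA * dB) ^ 2 - 4)) * (dA * dB - 2 * p)

/-- The coefficient `c₁`. -/
noncomputable def coeff1 (dA dB : ℝ) : ℝ :=
  ((dA * dB) ^ 2 * (dA ^ 2 + dB ^ 2 - 6) + 4) / (((dA * dB) ^ 2 - 1) * ((dA * dB) ^ 2 - 4))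

/-- The coefficient `c₂`. -/
noncomputable def coeff2 (dA dB : ℝ) : ℝ :=
  2 * (dA * dB) * (dA ^ 2 - 1) * (dB ^ 2 - 1) / (((dA * dB) ^ 2 - 1) * ((dA * dB) ^ 2 - 4))

/-- The matrix `σ = c₀ 𝟙 + c₁ ρ + c₂ ρ²`. -/
noncomputable def sigmaState {a b : Type*} [Fintype a] [DecidableEq a] [Fintype b]
    [DecidableEq b] (ρ : Matrix (a × b) (a × b) ℂ) : Matrix (a × b) (a × b) ℂ :=
  coeff0 (Fintype.card a) (Fintype.card b) (ρ ^ 2).trace.re • (1 : Matrix (a × b) (a × b) ℂ)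
    + coeff1 (Fintype.card a) (Fintype.card b) • ρ
    + coeff2 (Fintype.card a) (Fintype.card b) • ρ ^ 2

/-- The maximally mixed state `(𝟙_A / d_A) ⊗ (𝟙_B / d_B)`. -/
noncomputable def maximallyMixed (a b : Type*) [Fintype a] [DecidableEq a] [Fintype b]
    [DecidableEq b] : Matrix (a × b) (a × b) ℂ :=
  ((Fintype.card a : ℝ)⁻¹ • (1 : Matrix a a ℂ)) ⊗ₖ ((Fintype.card b : ℝ)⁻¹ • (1 : Matrix b b ℂ))

/-! Write `K(U) = ρ'_A ⊗ ρ'_B` and let `P_r` be the eigenprojections of `ρ'`. The point is that `σ`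
is the average of `U† K(U) U`. It is used in the weak form `∫ Tr (g(ρ') K(U)) dμ = Tr (g(ρ) σ)` with
`g` diagonal in the eigenbasis of `ρ` (`integral_re_trace_mul_kronecker`). Both entropy bounds are
then one linearisation of the logarithm, averaged over the orbit.

Upper bound: `S_A + S_B = S(K)`, and Klein's inequality against the rotated state `U σ U†` gives
`S(K) ≤ -Tr (K ln (U σ U†))`, whose average is `S(σ)`. Lower bound: `S_A + S_B = -Tr (ρ' ln K)` as
well (`trace_mul_matLog_reducedA_kronecker_reducedB`), and the tangent line of `ln` at `U σ U†`
(`trace_mul_log_le`) bounds this below by `1 - Tr (ρ ln σ) - Tr (g(ρ') K)`, with `g = ρ σ⁻¹`. The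
last term averages to `Tr ρ = 1`, which leaves `-Tr (ρ ln σ) = S(ρ) + S(ρ‖σ)`. Since `S(ρ') = S(ρ)`,
subtracting it turns these bounds into the ones on mutual information.

For the average itself, expand over eigenvectors: what is needed is the mean of `Tr ((Tr_B P_r ⊗
Tr_A P_s) P_p)`. Right invariance makes it depend only on which of `r, s, p` coincide, so there are
five unknowns. The value at `r = s = p` is a sixth moment of one Haar column. The other four follow
from the resolution of the identity in `r`, `s` or `p` and the mean purity of a marginal
(`exists_integral_marginalOverlap_eq`). The column moments use only phases, transpositions and one
reflection as test unitaries (`integral_columnMonomial`). -/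

/-! ### Calculus with explicit diagonalisations -/

section Spectral

variable {n : Type*} [Fintype n] [DecidableEq n]

/-- The Hermitian matrix `V diag(x) V†` with eigenvectors the columns of `V` and eigenvalues `x`. -/
noncomputable def spectralMatrix (V : unitaryGroup n ℂ) (x : n → ℝ) : Matrix n n ℂ :=
  (V : Matrix n n ℂ) * diagonal (fun i => (x i : ℂ)) * (V : Matrix n n ℂ)ᴴ

lemma unitary_conjTranspose_mul (V : unitaryGroup n ℂ) :
    (V : Matrix n n ℂ)ᴴ * (V : Matrix n n ℂ) = 1 := V.2.1

lemma unitary_mul_conjTranspose (V : unitaryGroup n ℂ) :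
    (V : Matrix n n ℂ) * (V : Matrix n n ℂ)ᴴ = 1 := V.2.2

lemma spectralMatrix_isHermitian (V : unitaryGroup n ℂ) (x : n → ℝ) :
    (spectralMatrix V x).IsHermitian := by
  have h : (diagonal (fun i => (x i : ℂ)))ᴴ = diagonal (fun i => (x i : ℂ)) := by
    rw [diagonal_conjTranspose]
    congr 1
    ext i
    simp
  rw [IsHermitian, spectralMatrix, conjTranspose_mul, conjTranspose_mul, h,
    conjTranspose_conjTranspose, Matrix.mul_assoc]

lemma exists_spectralMatrix {A : Matrix n n ℂ} (hA : A.IsHermitian) :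
    ∃ (V : unitaryGroup n ℂ) (x : n → ℝ), A = spectralMatrix V x :=
  ⟨hA.eigenvectorUnitary, hA.eigenvalues, hA.spectral_theorem⟩

/-- The intertwiner `Z = V†W` satisfies `x i * Z i j = Z i j * y j`, so `x i = y j` wherever `Z i j
≠ 0`, and any `f` preserves this relation. Hence functional calculus may be computed in any
eigenbasis, not only in the one chosen by `eigenvectorUnitary`. -/
lemma spectralMatrix_comp_congr {V W : unitaryGroup n ℂ} {x y : n → ℝ}
    (h : spectralMatrix V x = spectralMatrix W y) (f : ℝ → ℝ) :
    spectralMatrix V (f ∘ x) = spectralMatrix W (f ∘ y) := by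
  set Z : Matrix n n ℂ := (V : Matrix n n ℂ)ᴴ * (W : Matrix n n ℂ) with hZ
  have hVZ : (V : Matrix n n ℂ) * Z = W := by
    rw [hZ, ← Matrix.mul_assoc, unitary_mul_conjTranspose, Matrix.one_mul]
  have hZW : Z * (W : Matrix n n ℂ)ᴴ = (V : Matrix n n ℂ)ᴴ := by
    rw [hZ, Matrix.mul_assoc, unitary_mul_conjTranspose, Matrix.mul_one]
  have key : diagonal (fun i => (x i : ℂ)) * Z = Z * diagonal (fun i => (y i : ℂ)) := by
    have h1 := congrArg (fun M => (V : Matrix n n ℂ)ᴴ * M * (W : Matrix n n ℂ)) h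
    simp only [spectralMatrix, Matrix.mul_assoc, unitary_conjTranspose_mul, Matrix.mul_one] at h1
    simpa only [← Matrix.mul_assoc, unitary_conjTranspose_mul, Matrix.one_mul, hZ] using h1
  have key' : diagonal (fun i => ((f ∘ x) i : ℂ)) * Z =
      Z * diagonal (fun i => ((f ∘ y) i : ℂ)) := by
    ext i j
    have h2 := congrFun (congrFun key i) j
    simp only [diagonal_mul, mul_diagonal, Function.comp_apply] at h2 ⊢
    by_cases hz : Z i j = 0
    · simp [hz]
    · rw [mul_comm] at h2
      have h3 : x i = y j := by exact_mod_cast mul_left_cancel₀ hz h2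
      rw [h3, mul_comm]
  calc spectralMatrix V (f ∘ x)
      = V * (diagonal (fun i => ((f ∘ x) i : ℂ)) * Z) * (W : Matrix n n ℂ)ᴴ := by
        rw [spectralMatrix, ← hZW]
        simp only [Matrix.mul_assoc]
    _ = spectralMatrix W (f ∘ y) := by
        rw [key', ← Matrix.mul_assoc, hVZ, spectralMatrix]

lemma cfc_spectralMatrix (f : ℝ → ℝ) (V : unitaryGroup n ℂ) (x : n → ℝ) :
    cfc f (spectralMatrix V x) = spectralMatrix V (f ∘ x) := by
  have hA := spectralMatrix_isHermitian V x
  rw [hA.cfc_eq]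
  exact (spectralMatrix_comp_congr (hA.spectral_theorem :
    spectralMatrix V x = spectralMatrix hA.eigenvectorUnitary hA.eigenvalues) f).symm

lemma matLog_spectralMatrix (V : unitaryGroup n ℂ) (x : n → ℝ) :
    matLog (spectralMatrix V x) = spectralMatrix V (fun i => Real.log (x i)) :=
  cfc_spectralMatrix _ _ _

lemma spectralMatrix_mul (V : unitaryGroup n ℂ) (x y : n → ℝ) :
    spectralMatrix V x * spectralMatrix V y = spectralMatrix V (fun i => x i * y i) := by
  have : diagonal (fun i => ((x i * y i : ℝ) : ℂ)) =
      diagonal (fun i => (x i : ℂ)) * diagonal (fun i => (y i : ℂ)) := by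
    rw [diagonal_mul_diagonal]; simp
  rw [spectralMatrix, spectralMatrix, spectralMatrix, this]
  simp only [Matrix.mul_assoc]
  rw [← Matrix.mul_assoc (V : Matrix n n ℂ)ᴴ (V : Matrix n n ℂ), unitary_conjTranspose_mul,
    Matrix.one_mul]

lemma spectralMatrix_add (V : unitaryGroup n ℂ) (x y : n → ℝ) :
    spectralMatrix V x + spectralMatrix V y = spectralMatrix V (fun i => x i + y i) := by
  rw [spectralMatrix, spectralMatrix, spectralMatrix, ← Matrix.add_mul, ← Matrix.mul_add,
    diagonal_add]
  simp

lemma spectralMatrix_smul (V : unitaryGroup n ℂ) (c : ℝ) (x : n → ℝ) :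
    c • spectralMatrix V x = spectralMatrix V (fun i => c * x i) := by
  have : diagonal (fun i => ((c * x i : ℝ) : ℂ)) = c • diagonal (fun i => (x i : ℂ)) := by
    ext i j
    by_cases h : i = j
    · subst h; simp
    · simp [h]
  rw [spectralMatrix, spectralMatrix, this, Matrix.mul_smul, Matrix.smul_mul]

lemma spectralMatrix_one (V : unitaryGroup n ℂ) : spectralMatrix V (fun _ => 1) = 1 := by
  simp [spectralMatrix, unitary_mul_conjTranspose]

lemma spectralMatrix_unitary_mul (U V : unitaryGroup n ℂ) (x : n → ℝ) :
    orbitState (spectralMatrix V x) U = spectralMatrix (U * V) x := by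
  simp [orbitState, spectralMatrix, Matrix.mul_assoc, conjTranspose_mul]

lemma trace_spectralMatrix (V : unitaryGroup n ℂ) (x : n → ℝ) :
    (spectralMatrix V x).trace = ((∑ i, x i : ℝ) : ℂ) := by
  rw [spectralMatrix, trace_mul_comm, ← Matrix.mul_assoc, unitary_conjTranspose_mul,
    Matrix.one_mul, trace_diagonal]
  simp

lemma spectralMatrix_injective (V : unitaryGroup n ℂ) :
    Function.Injective (spectralMatrix V) := by
  intro x y h
  have h1 := congrArg (fun M => (V : Matrix n n ℂ)ᴴ * M * (V : Matrix n n ℂ)) h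
  simp only [spectralMatrix, Matrix.mul_assoc, unitary_conjTranspose_mul, Matrix.mul_one] at h1
  simp only [← Matrix.mul_assoc, unitary_conjTranspose_mul, Matrix.one_mul] at h1
  ext i
  have := congrFun (diagonal_injective h1) i
  exact_mod_cast this

/-- The expectation value of `M` in the state given by the `i`-th column of `V`. -/
noncomputable def columnExpect (V : Matrix n n ℂ) (M : Matrix n n ℂ) (i : n) : ℝ :=
  (star (fun k => V k i) ⬝ᵥ (M *ᵥ fun k => V k i)).re

omit [DecidableEq n] in
lemma conj_mul_mul_apply (V M : Matrix n n ℂ) (i j : n) :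
    (Vᴴ * M * V) i j = star (fun k => V k i) ⬝ᵥ (M *ᵥ fun k => V k j) := by
  rw [Matrix.mul_assoc, Matrix.mul_apply]
  rfl

lemma re_trace_spectralMatrix_mul (V : unitaryGroup n ℂ) (x : n → ℝ) (M : Matrix n n ℂ) :
    (spectralMatrix V x * M).trace.re = ∑ i, x i * columnExpect V M i := by
  rw [spectralMatrix, Matrix.mul_assoc, trace_mul_comm, ← Matrix.mul_assoc, trace_mul_comm,
    Matrix.trace, Complex.re_sum]
  refine Finset.sum_congr rfl fun i _ => ?_
  rw [diag_apply, diagonal_mul, Matrix.mul_assoc, ← Matrix.mul_assoc, conj_mul_mul_apply,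
    Complex.re_ofReal_mul]
  rfl

lemma columnExpect_spectralMatrix (V W : unitaryGroup n ℂ) (y : n → ℝ) (i : n) :
    columnExpect V (spectralMatrix W y) i =
      ∑ j, y j * Complex.normSq (((W : Matrix n n ℂ)ᴴ * (V : Matrix n n ℂ)) j i) := by
  rw [columnExpect, ← conj_mul_mul_apply]
  have : (V : Matrix n n ℂ)ᴴ * spectralMatrix W y * (V : Matrix n n ℂ) =
      ((W : Matrix n n ℂ)ᴴ * (V : Matrix n n ℂ))ᴴ * (diagonal (fun i => (y i : ℂ)) *
        ((W : Matrix n n ℂ)ᴴ * (V : Matrix n n ℂ))) := by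
    simp [spectralMatrix, Matrix.mul_assoc, conjTranspose_mul]
  rw [this, Matrix.mul_apply, Complex.re_sum]
  refine Finset.sum_congr rfl fun j _ => ?_
  rw [conjTranspose_apply, diagonal_mul, mul_left_comm, Complex.re_ofReal_mul, Complex.star_def,
    ← Complex.normSq_eq_conj_mul_self, Complex.ofReal_re]

lemma re_trace_spectralMatrix_mul_spectralMatrix (V W : unitaryGroup n ℂ) (x y : n → ℝ) :
    (spectralMatrix V x * spectralMatrix W y).trace.re =
      ∑ i, ∑ j, x i * y j *
        Complex.normSq (((W : Matrix n n ℂ)ᴴ * (V : Matrix n n ℂ)) j i) := by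
  rw [re_trace_spectralMatrix_mul]
  simp only [columnExpect_spectralMatrix, Finset.mul_sum, mul_assoc]

lemma spectralMatrix_posSemidef {V : unitaryGroup n ℂ} {x : n → ℝ} (hx : ∀ i, 0 ≤ x i) :
    (spectralMatrix V x).PosSemidef := by
  refine PosSemidef.mul_mul_conjTranspose_same ?_ _
  exact PosSemidef.diagonal fun i => by simpa using hx i

lemma spectralMatrix_posDef {V : unitaryGroup n ℂ} {x : n → ℝ} (hx : ∀ i, 0 < x i) :
    (spectralMatrix V x).PosDef := by
  have hd : (diagonal (fun i => (x i : ℂ))).PosDef := PosDef.diagonal fun i => by simpa using hx i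
  refine hd.mul_mul_conjTranspose_same ?_
  have := unitary_mul_conjTranspose V
  intro v w hvw
  have h := congrArg (fun z => z ᵥ* (V : Matrix n n ℂ)ᴴ) hvw
  simpa [vecMul_vecMul, this] using h

omit [DecidableEq n] in
lemma columnExpect_nonneg {M : Matrix n n ℂ} (hM : M.PosSemidef) (V : Matrix n n ℂ) (i : n) :
    0 ≤ columnExpect V M i :=
  hM.re_dotProduct_nonneg _

lemma exists_spectralMatrix_of_posSemidef {A : Matrix n n ℂ} (hA : A.PosSemidef) :
    ∃ (V : unitaryGroup n ℂ) (x : n → ℝ), (∀ i, 0 ≤ x i) ∧ A = spectralMatrix V x :=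
  ⟨hA.1.eigenvectorUnitary, hA.1.eigenvalues, hA.eigenvalues_nonneg, hA.1.spectral_theorem⟩

lemma exists_spectralMatrix_of_isDensityMatrix {A : Matrix n n ℂ} (hA : IsDensityMatrix A) :
    ∃ (V : unitaryGroup n ℂ) (x : n → ℝ), (∀ i, 0 ≤ x i) ∧ ∑ i, x i = 1 ∧
      A = spectralMatrix V x := by
  obtain ⟨V, x, hx, rfl⟩ := exists_spectralMatrix_of_posSemidef hA.1
  refine ⟨V, x, hx, ?_, rfl⟩
  have := hA.2
  rw [trace_spectralMatrix] at this
  exact_mod_cast this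

lemma isDensityMatrix_spectralMatrix {V : unitaryGroup n ℂ} {x : n → ℝ} (hx : ∀ i, 0 ≤ x i)
    (h1 : ∑ i, x i = 1) : IsDensityMatrix (spectralMatrix V x) :=
  ⟨spectralMatrix_posSemidef hx, by rw [trace_spectralMatrix, h1, Complex.ofReal_one]⟩

end Spectral

/-! ### Entropy, Klein's inequality, tangent-line bound, continuity -/

section Entropy

variable {n : Type*} [Fintype n] [DecidableEq n]

lemma vnEntropy_spectralMatrix (V : unitaryGroup n ℂ) (x : n → ℝ) :
    vnEntropy (spectralMatrix V x) = -∑ i, x i * Real.log (x i) := by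
  rw [vnEntropy, matLog_spectralMatrix, spectralMatrix_mul, trace_spectralMatrix,
    Complex.ofReal_re]

lemma relEntropy_eq (A B : Matrix n n ℂ) :
    relEntropy A B = -vnEntropy A - (A * matLog B).trace.re := by
  simp [relEntropy, vnEntropy, Matrix.mul_sub, trace_sub]

/-- With its column counterpart, this makes the squared overlaps of two orthonormal bases doubly
stochastic, which reduces trace inequalities to scalar ones. -/
lemma sum_normSq_row (V W : unitaryGroup n ℂ) (j : n) :
    ∑ i, Complex.normSq (((W : Matrix n n ℂ)ᴴ * (V : Matrix n n ℂ)) j i) = 1 := by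
  have h := congrFun (congrFun (unitary_mul_conjTranspose (W⁻¹ * V)) j) j
  rw [Matrix.mul_apply, one_apply_eq] at h
  have h2 : ∀ i, ((W⁻¹ * V : unitaryGroup n ℂ) : Matrix n n ℂ) j i *
      ((W⁻¹ * V : unitaryGroup n ℂ) : Matrix n n ℂ)ᴴ i j =
      (Complex.normSq (((W : Matrix n n ℂ)ᴴ * (V : Matrix n n ℂ)) j i) : ℂ) := by
    intro i
    rw [conjTranspose_apply, Complex.star_def, Complex.mul_conj]
    rfl
  simp only [h2] at h
  exact_mod_cast h

lemma sum_normSq_col (V W : unitaryGroup n ℂ) (i : n) :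
    ∑ j, Complex.normSq (((W : Matrix n n ℂ)ᴴ * (V : Matrix n n ℂ)) j i) = 1 := by
  rw [← sum_normSq_row W V i]
  refine Finset.sum_congr rfl fun j _ => ?_
  have : ((V : Matrix n n ℂ)ᴴ * (W : Matrix n n ℂ)) =
    ((W : Matrix n n ℂ)ᴴ * (V : Matrix n n ℂ))ᴴ := by
    rw [conjTranspose_mul, conjTranspose_conjTranspose]
  rw [this, conjTranspose_apply, Complex.star_def, Complex.normSq_conj]

/-- **Klein's inequality**: the relative entropy of states is nonnegative. -/
lemma vnEntropy_le_neg_trace_mul_log (V W : unitaryGroup n ℂ) {x y : n → ℝ} (hx : ∀ i, 0 ≤ x i)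
    (hx1 : ∑ i, x i = 1) (hy : ∀ i, 0 < y i) (hy1 : ∑ i, y i = 1) :
    vnEntropy (spectralMatrix V x) ≤
      -(spectralMatrix V x * matLog (spectralMatrix W y)).trace.re := by
  rw [vnEntropy_spectralMatrix, matLog_spectralMatrix,
    re_trace_spectralMatrix_mul_spectralMatrix]
  set c : n → n → ℝ := fun i j =>
    Complex.normSq (((W : Matrix n n ℂ)ᴴ * (V : Matrix n n ℂ)) j i) with hc
  have e1 : ∑ i, x i * Real.log (x i) = ∑ i, ∑ j, x i * Real.log (x i) * c i j := by
    simp only [← Finset.mul_sum, hc, sum_normSq_col, mul_one]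
  have e2 : (0 : ℝ) = ∑ i, ∑ j, (x i - y j) * c i j := by
    simp only [sub_mul, Finset.sum_sub_distrib]
    rw [Finset.sum_comm (f := fun i j => y j * c i j)]
    simp only [← Finset.mul_sum, hc, sum_normSq_col, sum_normSq_row, mul_one, hx1, hy1, sub_self]
  -- This is `ln u ≤ u - 1` at `u = y j / x i`, multiplied by `x i`. For `x i = 0` it reads `-y j ≤
  -- 0`, because `0 * log 0 = 0`.
  have key : ∀ i j, (x i - y j) * c i j ≤
      x i * Real.log (x i) * c i j - x i * Real.log (y j) * c i j := by
    intro i j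
    rw [← sub_mul]
    refine mul_le_mul_of_nonneg_right ?_ (Complex.normSq_nonneg _)
    rcases (hx i).eq_or_lt with h0 | h0
    · simp [← h0, (hy j).le]
    · have := Real.log_le_sub_one_of_pos (div_pos (hy j) h0)
      rw [Real.log_div (hy j).ne' h0.ne'] at this
      have h3 := mul_le_mul_of_nonneg_left this h0.le
      have h4 : x i * (y j / x i - 1) = y j - x i := by field_simp
      linarith
  have : (0 : ℝ) ≤ ∑ i, ∑ j, (x i * Real.log (x i) * c i j - x i * Real.log (y j) * c i j) := by
    rw [e2]
    exact Finset.sum_le_sum fun i _ => Finset.sum_le_sum fun j _ => key i j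
  simp only [Finset.sum_sub_distrib] at this
  linarith

/-- The tangent-line bound for `B ↦ Tr (A log B)` at a positive matrix with the eigenvectors of `A`
and the eigenvalues `s`. -/
lemma trace_mul_log_le (V : unitaryGroup n ℂ) {x s : n → ℝ} (hx : ∀ i, 0 ≤ x i)
    (hs : ∀ i, 0 < s i) {B : Matrix n n ℂ} (hB : B.PosSemidef)
    (hle : SupportLE (spectralMatrix V x) B) :
    (spectralMatrix V x * matLog B).trace.re ≤
      ∑ i, x i * Real.log (s i) + (spectralMatrix V (fun i => x i / s i) * B).trace.re
        - ∑ i, x i := by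
  obtain ⟨W, y, hy, rfl⟩ := exists_spectralMatrix_of_posSemidef hB
  rw [matLog_spectralMatrix, re_trace_spectralMatrix_mul_spectralMatrix,
    re_trace_spectralMatrix_mul_spectralMatrix]
  set c : n → n → ℝ := fun i j =>
    Complex.normSq (((W : Matrix n n ℂ)ᴴ * (V : Matrix n n ℂ)) j i) with hc
  have e1 : ∑ i, x i * Real.log (s i) = ∑ i, ∑ j, x i * Real.log (s i) * c i j := by
    simp only [← Finset.mul_sum, hc, sum_normSq_col, mul_one]
  have e2 : ∑ i, x i = ∑ i, ∑ j, x i * c i j := by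
    simp only [← Finset.mul_sum, hc, sum_normSq_col, mul_one]
  rw [e1, e2, ← Finset.sum_add_distrib, ← Finset.sum_sub_distrib]
  refine Finset.sum_le_sum fun i _ => ?_
  rw [← Finset.sum_add_distrib, ← Finset.sum_sub_distrib]
  refine Finset.sum_le_sum fun j _ => ?_
  rw [← add_mul, ← sub_mul]
  -- Terms of zero weight must be removed first: there `y j` may vanish and `Real.log 0 = 0` is
  -- meaningless for the tangent line.
  by_cases hz : x i * c i j = 0
  · rcases mul_eq_zero.mp hz with h | h
    · simp [h]
    · change x i * Real.log (y j) * c i j ≤ _ * c i j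
      rw [h, mul_zero, mul_zero]
  refine mul_le_mul_of_nonneg_right ?_ (Complex.normSq_nonneg _)
  -- If `y j = 0`, the `j`-th column of `W` lies in the kernel of `B`, hence in that of the first
  -- matrix. Its `i`-th component in the basis `V` then gives `x i * c i j = 0`.
  have hy0 : 0 < y j := by
    refine lt_of_le_of_ne (hy j) fun h0 => hz ?_
    have hker : spectralMatrix W y *ᵥ (fun k => (W : Matrix n n ℂ) k j) = 0 := by
      have h1 : (fun k => (W : Matrix n n ℂ) k j) = (W : Matrix n n ℂ) *ᵥ Pi.single j 1 := by
        ext k; simp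
      rw [h1, mulVec_mulVec, spectralMatrix, Matrix.mul_assoc, unitary_conjTranspose_mul,
        Matrix.mul_one, ← mulVec_mulVec, diagonal_mulVec_single, ← h0]
      simp
    have h2 := congrArg (fun v => ((V : Matrix n n ℂ)ᴴ *ᵥ v) i) (hle _ hker)
    have h1 : (fun k => (W : Matrix n n ℂ) k j) = (W : Matrix n n ℂ) *ᵥ Pi.single j 1 := by
      ext k; simp
    simp only [spectralMatrix, mulVec_mulVec, ← Matrix.mul_assoc, unitary_conjTranspose_mul,
      Matrix.one_mul, h1, mulVec_zero, Pi.zero_apply] at h2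
    rw [Matrix.mul_assoc] at h2
    simp only [mulVec_single_one, col_apply, diagonal_mul] at h2
    have h5 : (V : Matrix n n ℂ)ᴴ * (W : Matrix n n ℂ) =
        ((W : Matrix n n ℂ)ᴴ * (V : Matrix n n ℂ))ᴴ := by
      rw [conjTranspose_mul, conjTranspose_conjTranspose]
    rw [h5, conjTranspose_apply] at h2
    rcases mul_eq_zero.mp h2 with h | h
    · rw [Complex.ofReal_eq_zero.mp h, zero_mul]
    · simp only [hc]
      rw [star_eq_zero.mp h]
      simp
  have := Real.log_le_sub_one_of_pos (div_pos hy0 (hs i))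
  rw [Real.log_div hy0.ne' (hs i).ne'] at this
  have h3 := mul_le_mul_of_nonneg_left this (hx i)
  have h4 : x i * (y j / s i - 1) = x i / s i * y j - x i := by ring
  linarith

section Continuity

open scoped Matrix.Norms.L2Operator

/-- Unlike `log`, the function `negMulLog` is continuous at `0`, so this form gives continuity of
the entropy on singular states too. -/
lemma vnEntropy_eq_trace_cfc_negMulLog {A : Matrix n n ℂ} (hA : A.IsHermitian) :
    vnEntropy A = (cfc Real.negMulLog A).trace.re := by
  obtain ⟨V, x, rfl⟩ := exists_spectralMatrix hA
  rw [vnEntropy_spectralMatrix, cfc_spectralMatrix, trace_spectralMatrix, Complex.ofReal_re,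
    ← Finset.sum_neg_distrib]
  simp [Real.negMulLog]

lemma spectrum_subset_Icc_of_isDensityMatrix {A : Matrix n n ℂ} (hA : IsDensityMatrix A) :
    spectrum ℝ A ⊆ Set.Icc 0 1 := by
  rw [hA.1.1.spectrum_real_eq_range_eigenvalues]
  rintro _ ⟨i, rfl⟩
  have h1 : ∑ i, hA.1.1.eigenvalues i = 1 := by
    apply Complex.ofReal_injective
    rw [Complex.ofReal_sum, Complex.ofReal_one]
    exact hA.1.1.trace_eq_sum_eigenvalues.symm.trans hA.2
  refine ⟨hA.1.eigenvalues_nonneg i, ?_⟩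
  rw [← h1]
  exact Finset.single_le_sum (fun j _ => hA.1.eigenvalues_nonneg j) (Finset.mem_univ i)

lemma continuous_vnEntropy {X : Type*} [TopologicalSpace X] {A : X → Matrix n n ℂ}
    (h : Continuous A) (hA : ∀ x, IsDensityMatrix (A x)) :
    Continuous fun x => vnEntropy (A x) := by
  simp only [fun x => vnEntropy_eq_trace_cfc_negMulLog (hA x).1.1]
  have : Continuous fun x => cfc Real.negMulLog (A x) :=
    Continuous.cfc' isCompact_Icc _ h (fun x => spectrum_subset_Icc_of_isDensityMatrix (hA x))
      Real.continuous_negMulLog.continuousOn (fun x => (hA x).1.1)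
  exact Complex.continuous_re.comp this.matrix_trace

end Continuity

end Entropy

/-! ### Marginals, product eigenbases, mutual information -/

section Bipartite

variable {a b : Type*} [Fintype a] [DecidableEq a] [Fintype b] [DecidableEq b]

omit [Fintype a] [DecidableEq a] [DecidableEq b] in
lemma reducedA_posSemidef [Finite a] {ρ : Matrix (a × b) (a × b) ℂ} (h : ρ.PosSemidef) :
    (reducedA ρ).PosSemidef := by
  have : reducedA ρ = ∑ j, ρ.submatrix (fun i => (i, j)) (fun i => (i, j)) := by
    ext i k
    simp [reducedA, Matrix.sum_apply]
  rw [this]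
  exact posSemidef_sum _ fun j _ => h.submatrix _

omit [DecidableEq a] [Fintype b] [DecidableEq b] in
lemma reducedB_posSemidef [Finite b] {ρ : Matrix (a × b) (a × b) ℂ} (h : ρ.PosSemidef) :
    (reducedB ρ).PosSemidef := by
  have : reducedB ρ = ∑ i, ρ.submatrix (fun j => (i, j)) (fun j => (i, j)) := by
    ext i k
    simp [reducedB, Matrix.sum_apply]
  rw [this]
  exact posSemidef_sum _ fun j _ => h.submatrix _

omit [DecidableEq a] [DecidableEq b] in
lemma trace_reducedA (ρ : Matrix (a × b) (a × b) ℂ) : (reducedA ρ).trace = ρ.trace := by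
  simp [reducedA, Matrix.trace, Fintype.sum_prod_type]

omit [DecidableEq a] [DecidableEq b] in
lemma trace_reducedB (ρ : Matrix (a × b) (a × b) ℂ) : (reducedB ρ).trace = ρ.trace := by
  simp only [reducedB, Matrix.trace, Fintype.sum_prod_type, diag_apply, of_apply]
  exact Finset.sum_comm

omit [DecidableEq a] [DecidableEq b] in
lemma isDensityMatrix_reducedA {ρ : Matrix (a × b) (a × b) ℂ} (h : IsDensityMatrix ρ) :
    IsDensityMatrix (reducedA ρ) :=
  ⟨reducedA_posSemidef h.1, (trace_reducedA ρ).trans h.2⟩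

omit [DecidableEq a] [DecidableEq b] in
lemma isDensityMatrix_reducedB {ρ : Matrix (a × b) (a × b) ℂ} (h : IsDensityMatrix ρ) :
    IsDensityMatrix (reducedB ρ) :=
  ⟨reducedB_posSemidef h.1, (trace_reducedB ρ).trans h.2⟩

omit [DecidableEq a] in
lemma trace_kronecker_one_mul (Z : Matrix a a ℂ) (ρ : Matrix (a × b) (a × b) ℂ) :
    ((Z ⊗ₖ (1 : Matrix b b ℂ)) * ρ).trace = (Z * reducedA ρ).trace := by
  simp only [Matrix.trace, diag_apply, Matrix.mul_apply, Fintype.sum_prod_type, kroneckerMap_apply,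
    reducedA, of_apply, one_apply, mul_ite, mul_one, mul_zero, ite_mul, zero_mul,
    Finset.sum_ite_eq, Finset.mem_univ, if_true, Finset.mul_sum]
  exact Finset.sum_congr rfl fun i _ => Finset.sum_comm

omit [DecidableEq b] in
lemma trace_one_kronecker_mul (Z : Matrix b b ℂ) (ρ : Matrix (a × b) (a × b) ℂ) :
    (((1 : Matrix a a ℂ) ⊗ₖ Z) * ρ).trace = (Z * reducedB ρ).trace := by
  simp only [Matrix.trace, diag_apply, Matrix.mul_apply, Fintype.sum_prod_type, kroneckerMap_apply,
    reducedB, of_apply, one_apply, ite_mul, one_mul, zero_mul, Finset.mul_sum]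
  have : ∀ (x : a) (y : b), ∑ z : a, ∑ w : b, (if x = z then Z y w * ρ (z, w) (x, y) else 0) =
      ∑ w : b, Z y w * ρ (x, w) (x, y) := by
    intro x y
    rw [Finset.sum_comm]
    simp
  simp only [this]
  rw [Finset.sum_comm]
  exact Finset.sum_congr rfl fun i _ => Finset.sum_comm

/-- The product basis of the columns of two unitary matrices. -/
noncomputable def kroneckerUnitary (V : unitaryGroup a ℂ) (W : unitaryGroup b ℂ) :
    unitaryGroup (a × b) ℂ :=
  ⟨(V : Matrix a a ℂ) ⊗ₖ (W : Matrix b b ℂ), kronecker_mem_unitary V.2 W.2⟩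

lemma spectralMatrix_kronecker (V : unitaryGroup a ℂ) (W : unitaryGroup b ℂ) (x : a → ℝ)
    (y : b → ℝ) : spectralMatrix V x ⊗ₖ spectralMatrix W y =
      spectralMatrix (kroneckerUnitary V W) (fun p => x p.1 * y p.2) := by
  rw [spectralMatrix, spectralMatrix, mul_kronecker_mul, mul_kronecker_mul, spectralMatrix,
    ← conjTranspose_kronecker, diagonal_kronecker_diagonal]
  simp [kroneckerUnitary]

variable {ρ : Matrix (a × b) (a × b) ℂ} {V : unitaryGroup a ℂ} {W : unitaryGroup b ℂ}
  {x : a → ℝ} {y : b → ℝ}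

/-- The diagonal of `ρ` in the product of the marginal eigenbases behaves as a joint distribution;
this computes its first marginal as the spectrum of `reducedA ρ`, tested against `z`. -/
lemma sum_fst_mul_columnExpect (hA : reducedA ρ = spectralMatrix V x) (z : a → ℝ) :
    ∑ p, z p.1 * columnExpect (kroneckerUnitary V W : Matrix (a × b) (a × b) ℂ) ρ p =
      ∑ i, z i * x i := by
  have h := congrArg Complex.re (trace_kronecker_one_mul (spectralMatrix V z) ρ)
  rw [← spectralMatrix_one W, spectralMatrix_kronecker, re_trace_spectralMatrix_mul, hA,
    spectralMatrix_mul, trace_spectralMatrix, Complex.ofReal_re] at h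
  simpa using h

lemma sum_snd_mul_columnExpect (hB : reducedB ρ = spectralMatrix W y) (z : b → ℝ) :
    ∑ p, z p.2 * columnExpect (kroneckerUnitary V W : Matrix (a × b) (a × b) ℂ) ρ p =
      ∑ i, z i * y i := by
  have h := congrArg Complex.re (trace_one_kronecker_mul (spectralMatrix W z) ρ)
  rw [← spectralMatrix_one V, spectralMatrix_kronecker, re_trace_spectralMatrix_mul, hB,
    spectralMatrix_mul, trace_spectralMatrix, Complex.ofReal_re] at h
  simpa using h

/-- A nonnegative joint weight vanishes wherever one of its marginals does. This handles all zero
eigenvalues of the product of the marginals. -/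
lemma columnExpect_eq_zero_of_mul_eq_zero (hρ : ρ.PosSemidef)
    (hA : reducedA ρ = spectralMatrix V x) (hB : reducedB ρ = spectralMatrix W y) {p : a × b}
    (hp : x p.1 * y p.2 = 0) :
    columnExpect (kroneckerUnitary V W : Matrix (a × b) (a × b) ℂ) ρ p = 0 := by
  have hnn := columnExpect_nonneg hρ (kroneckerUnitary V W : Matrix (a × b) (a × b) ℂ)
  have of_sum : ∀ z : a × b → ℝ, (∀ q, 0 ≤ z q) → z p = 1 →
      ∑ q, z q * columnExpect (kroneckerUnitary V W : Matrix (a × b) (a × b) ℂ) ρ q = 0 →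
      columnExpect (kroneckerUnitary V W : Matrix (a × b) (a × b) ℂ) ρ p = 0 := by
    intro z hz hzp h
    have := (Finset.sum_eq_zero_iff_of_nonneg fun q _ => mul_nonneg (hz q) (hnn q)).mp h p
      (Finset.mem_univ p)
    simpa [hzp] using this
  rcases mul_eq_zero.mp hp with h | h
  · refine of_sum (fun q => (Pi.single p.1 1 : a → ℝ) q.1) (fun q => ?_) (by simp) ?_
    · rw [Pi.single_apply]; split_ifs <;> simp
    · rw [sum_fst_mul_columnExpect hA, Finset.sum_eq_single p.1] <;>
        simp +contextual [h]
  · refine of_sum (fun q => (Pi.single p.2 1 : b → ℝ) q.2) (fun q => ?_) (by simp) ?_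
    · rw [Pi.single_apply]; split_ifs <;> simp
    · rw [sum_snd_mul_columnExpect hB, Finset.sum_eq_single p.2] <;>
        simp +contextual [h]

/-- The support of a positive matrix is contained in that of the product of its marginals. -/
lemma supportLE_reducedA_kronecker_reducedB (hρ : ρ.PosSemidef) :
    SupportLE ρ (reducedA ρ ⊗ₖ reducedB ρ) := by
  obtain ⟨V, x, hx, hA⟩ := exists_spectralMatrix_of_posSemidef (reducedA_posSemidef hρ)
  obtain ⟨W, y, hy, hB⟩ := exists_spectralMatrix_of_posSemidef (reducedB_posSemidef hρ)
  intro v hv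
  rw [hA, hB, spectralMatrix_kronecker] at hv
  set T := kroneckerUnitary V W
  set u := (T : Matrix (a × b) (a × b) ℂ)ᴴ *ᵥ v with hu
  have hvu : (T : Matrix (a × b) (a × b) ℂ) *ᵥ u = v := by
    rw [hu, mulVec_mulVec, unitary_mul_conjTranspose, one_mulVec]
  have h1 : diagonal (fun p => ((x p.1 * y p.2 : ℝ) : ℂ)) *ᵥ u = 0 := by
    have := congrArg (fun w => (T : Matrix (a × b) (a × b) ℂ)ᴴ *ᵥ w) hv
    simp only [spectralMatrix, mulVec_mulVec, ← Matrix.mul_assoc, unitary_conjTranspose_mul,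
      Matrix.one_mul, mulVec_zero] at this
    rwa [← mulVec_mulVec] at this
  rw [← hvu, mulVec_mulVec, mulVec_eq_sum]
  refine Finset.sum_eq_zero fun p _ => ?_
  have h2 := congrFun h1 p
  rw [mulVec_diagonal, Pi.zero_apply, mul_eq_zero] at h2
  rcases h2 with h | h
  -- For a positive semidefinite matrix, zero expectation in a vector forces the vector into the
  -- kernel.
  · have h3 := columnExpect_eq_zero_of_mul_eq_zero hρ hA hB (Complex.ofReal_eq_zero.mp h)
    have h4 := hρ.dotProduct_mulVec_nonneg (fun k => (T : Matrix (a × b) (a × b) ℂ) k p)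
    have h5 := (hρ.dotProduct_mulVec_zero_iff (fun k => (T : Matrix (a × b) (a × b) ℂ) k p)).mp
      (Complex.ext h3 (Complex.le_def.mp h4).2.symm)
    have h6 : (ρ * (T : Matrix (a × b) (a × b) ℂ))ᵀ p =
      ρ *ᵥ (fun k => (T : Matrix (a × b) (a × b) ℂ) k p) := rfl
    rw [h6, h5, smul_zero]
  · rw [h]; simp

/-- In the product eigenbasis `log (x y) = log x + log y` splits the trace into the two marginal
ones. The splitting fails only where `x y = 0`, and there `ρ` has no weight. -/
lemma trace_mul_matLog_reducedA_kronecker_reducedB (hρ : ρ.PosSemidef) :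
    (ρ * matLog (reducedA ρ ⊗ₖ reducedB ρ)).trace.re =
      -vnEntropy (reducedA ρ) - vnEntropy (reducedB ρ) := by
  obtain ⟨V, x, hx, hA⟩ := exists_spectralMatrix_of_posSemidef (reducedA_posSemidef hρ)
  obtain ⟨W, y, hy, hB⟩ := exists_spectralMatrix_of_posSemidef (reducedB_posSemidef hρ)
  rw [hA, hB, spectralMatrix_kronecker, matLog_spectralMatrix, trace_mul_comm,
    re_trace_spectralMatrix_mul, vnEntropy_spectralMatrix, vnEntropy_spectralMatrix]
  simp only [mul_comm (x _) (Real.log _), mul_comm (y _) (Real.log _)]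
  rw [← sum_fst_mul_columnExpect (W := W) hA, ← sum_snd_mul_columnExpect (V := V) hB, neg_neg,
    sub_neg_eq_add, ← Finset.sum_add_distrib]
  refine Finset.sum_congr rfl fun p _ => ?_
  by_cases hp : x p.1 * y p.2 = 0
  · simp [columnExpect_eq_zero_of_mul_eq_zero hρ hA hB hp]
  · rw [Real.log_mul (left_ne_zero_of_mul hp) (right_ne_zero_of_mul hp), add_mul]

lemma mutualInfo_eq (hρ : ρ.PosSemidef) :
    mutualInfo ρ = vnEntropy (reducedA ρ) + vnEntropy (reducedB ρ) - vnEntropy ρ := by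
  rw [mutualInfo, relEntropy_eq, trace_mul_matLog_reducedA_kronecker_reducedB hρ]
  ring

lemma isDensityMatrix_kronecker {A : Matrix a a ℂ} {B : Matrix b b ℂ} (hA : IsDensityMatrix A)
    (hB : IsDensityMatrix B) : IsDensityMatrix (A ⊗ₖ B) := by
  refine ⟨?_, by rw [trace_kronecker, hA.2, hB.2, mul_one]⟩
  obtain ⟨V, x, hx, rfl⟩ := exists_spectralMatrix_of_posSemidef hA.1
  obtain ⟨W, y, hy, rfl⟩ := exists_spectralMatrix_of_posSemidef hB.1
  rw [spectralMatrix_kronecker]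
  exact spectralMatrix_posSemidef fun p => mul_nonneg (hx _) (hy _)

lemma vnEntropy_kronecker {A : Matrix a a ℂ} {B : Matrix b b ℂ} (hA : IsDensityMatrix A)
    (hB : IsDensityMatrix B) : vnEntropy (A ⊗ₖ B) = vnEntropy A + vnEntropy B := by
  obtain ⟨V, x, hx, hx1, rfl⟩ := exists_spectralMatrix_of_isDensityMatrix hA
  obtain ⟨W, y, hy, hy1, rfl⟩ := exists_spectralMatrix_of_isDensityMatrix hB
  rw [spectralMatrix_kronecker, vnEntropy_spectralMatrix, vnEntropy_spectralMatrix,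
    vnEntropy_spectralMatrix, Fintype.sum_prod_type]
  have : ∀ i j, x i * y j * Real.log (x i * y j) =
      y j * (x i * Real.log (x i)) + x i * (y j * Real.log (y j)) := by
    intro i j
    by_cases hi : x i = 0
    · simp [hi]
    by_cases hj : y j = 0
    · simp [hj]
    rw [Real.log_mul hi hj]
    ring
  simp only [this, Finset.sum_add_distrib, ← Finset.mul_sum, ← Finset.sum_mul, hx1, hy1, one_mul]
  ring

end Bipartite

/-! ### Haar measure on the unitary group and test unitaries -/

section HaarUnitary

variable {n : Type*} [Fintype n] [DecidableEq n]

lemma isClosed_unitaryGroup : IsClosed (unitaryGroup n ℂ : Set (Matrix n n ℂ)) := isClosed_unitary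

lemma isCompact_unitaryGroup : IsCompact (unitaryGroup n ℂ : Set (Matrix n n ℂ)) := by
  open scoped Matrix.Norms.Elementwise in
  refine Metric.isCompact_of_isClosed_isBounded isClosed_unitaryGroup
    ((Metric.isBounded_closedBall (x := (0 : Matrix n n ℂ)) (r := 1)).subset fun U hU => ?_)
  rw [mem_closedBall_zero_iff]
  exact entrywise_sup_norm_bound_of_unitary hU

instance compactSpace_unitaryGroup : CompactSpace (unitaryGroup n ℂ) :=
  isCompact_iff_compactSpace.mp isCompact_unitaryGroup

@[fun_prop]
lemma continuous_unitaryGroup_apply (p r : n) :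
    Continuous fun U : unitaryGroup n ℂ => (U : Matrix n n ℂ) p r :=
  (continuous_apply_apply p r).comp continuous_subtype_val

/-- The diagonal unitary multiplying the coordinate `z` by the phase `i`. -/
noncomputable def phaseUnitary (z : n) : unitaryGroup n ℂ :=
  ⟨diagonal fun i => if i = z then Complex.I else 1, by
    rw [mem_unitaryGroup_iff, star_eq_conjTranspose, diagonal_conjTranspose, diagonal_mul_diagonal,
      ← diagonal_one]
    congr 1
    ext i
    by_cases h : i = z <;> simp [h]⟩

lemma phaseUnitary_mul_apply (z : n) (U : unitaryGroup n ℂ) (p r : n) :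
    ((phaseUnitary z * U : unitaryGroup n ℂ) : Matrix n n ℂ) p r =
      (if p = z then Complex.I else 1) * (U : Matrix n n ℂ) p r := by
  simp [phaseUnitary, diagonal_mul]

/-- The Householder reflection in the hyperplane orthogonal to `e_x - t e_y`. -/
noncomputable def reflectionMatrix (x y : n) (t : ℝ) : Matrix n n ℂ :=
  1 - (2 / (1 + t ^ 2) : ℂ) • vecMulVec (Pi.single x 1 - Pi.single y (t : ℂ))
    (Pi.single x 1 - Pi.single y (t : ℂ))

lemma reflectionMatrix_mem {x y : n} (h : x ≠ y) (t : ℝ) :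
    reflectionMatrix x y t ∈ unitaryGroup n ℂ := by
  set w : n → ℂ := Pi.single x 1 - Pi.single y (t : ℂ) with hw
  have hs : star w = w := by
    ext i
    simp only [hw, Pi.star_apply, Pi.sub_apply, Pi.single_apply]
    split_ifs <;> simp
  have ht : (1 + (t : ℂ) ^ 2) ≠ 0 := by
    have : (0 : ℝ) < 1 + t ^ 2 := by positivity
    exact_mod_cast this.ne'
  have hww : w ⬝ᵥ w = 1 + (t : ℂ) ^ 2 := by
    simp [hw, h, h.symm]
    ring
  have hstar : star (reflectionMatrix x y t) = reflectionMatrix x y t := by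
    rw [reflectionMatrix, ← hw, star_eq_conjTranspose, conjTranspose_sub, conjTranspose_one,
      conjTranspose_smul, conjTranspose_vecMulVec, hs]
    congr 2
    simp
  rw [mem_unitaryGroup_iff, hstar, reflectionMatrix, ← hw, Matrix.sub_mul, Matrix.mul_sub,
    Matrix.mul_sub, Matrix.one_mul, Matrix.mul_one, Matrix.one_mul, Matrix.smul_mul,
    Matrix.mul_smul, vecMulVec_mul_vecMulVec, hww]
  ext i j
  simp only [Matrix.sub_apply, Matrix.smul_apply, vecMulVec_apply, smul_eq_mul, Pi.smul_apply]
  field_simp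
  ring

/-- The Householder reflection as an element of the unitary group. -/
noncomputable def reflectionUnitary {x y : n} (h : x ≠ y) (t : ℝ) : unitaryGroup n ℂ :=
  ⟨reflectionMatrix x y t, reflectionMatrix_mem h t⟩

lemma reflectionUnitary_mul_apply {x y : n} (h : x ≠ y) (t : ℝ) (U : unitaryGroup n ℂ) (p r : n) :
    ((reflectionUnitary h t * U : unitaryGroup n ℂ) : Matrix n n ℂ) p r =
      (U : Matrix n n ℂ) p r -
        2 / (1 + t ^ 2) * ((if p = x then 1 else 0) - if p = y then (t : ℂ) else 0) *
        ((U : Matrix n n ℂ) x r - t * (U : Matrix n n ℂ) y r) := by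
  change (reflectionMatrix x y t * (U : Matrix n n ℂ)) p r = _
  rw [reflectionMatrix, Matrix.sub_mul, Matrix.one_mul, Matrix.smul_mul, vecMulVec_mul,
    Matrix.sub_apply, Matrix.smul_apply, vecMulVec_apply, sub_vecMul, Pi.sub_apply]
  simp [Pi.single_apply, single_vecMul]
  ring

/-- At `t = 1` the reflection is the permutation matrix of a transposition, so one family supplies
both the permutations and the genuine mixing of two coordinates. -/
lemma reflectionUnitary_one_mul_apply {x y : n} (h : x ≠ y) (U : unitaryGroup n ℂ) (p r : n) :
    ((reflectionUnitary h 1 * U : unitaryGroup n ℂ) : Matrix n n ℂ) p r =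
      (U : Matrix n n ℂ) (Equiv.swap x y p) r := by
  rw [reflectionUnitary_mul_apply]
  by_cases hx : p = x
  · subst hx
    simp [h]
    ring
  by_cases hy : p = y
  · subst hy
    simp [h.symm]
    ring
  simp [hx, hy, Equiv.swap_apply_of_ne_of_ne hx hy]

lemma mul_reflectionUnitary_one_apply {x y : n} (h : x ≠ y) (U : unitaryGroup n ℂ) (p r : n) :
    ((U * reflectionUnitary h 1 : unitaryGroup n ℂ) : Matrix n n ℂ) p r =
      (U : Matrix n n ℂ) p (Equiv.swap x y r) := by
  change ((U : Matrix n n ℂ) * reflectionMatrix x y 1) p r = _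
  rw [reflectionMatrix, Matrix.mul_sub, Matrix.mul_one, Matrix.mul_smul, mul_vecMulVec,
    Matrix.sub_apply, Matrix.smul_apply, vecMulVec_apply, mulVec_sub, Pi.sub_apply]
  by_cases hx : r = x
  · subst hx
    simp [h]
    ring
  by_cases hy : r = y
  · subst hy
    simp [h.symm]
    ring
  simp [hx, hy, Equiv.swap_apply_of_ne_of_ne hx hy]

/-- `|U_{pr}|²`, as a complex number. -/
noncomputable def entrySq (r p : n) (U : unitaryGroup n ℂ) : ℂ :=
  (U : Matrix n n ℂ) p r * star ((U : Matrix n n ℂ) p r)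

@[fun_prop]
lemma continuous_entrySq (r p : n) : Continuous (entrySq r p) := by
  unfold entrySq
  fun_prop

/-- The product is `i ^ (k - l)`, and `i` has order four; exponents up to three are all that sixth
moments require. -/
lemma I_pow_mul_neg_I_pow_ne_one {k l : ℕ} (hk : k ≤ 3) (hl : l ≤ 3) (h : k ≠ l) :
    Complex.I ^ k * (star Complex.I) ^ l ≠ 1 := by
  rw [Complex.star_def, Complex.conj_I]
  have h2 : Complex.I ^ 3 = -Complex.I := by rw [pow_succ, Complex.I_sq]; ring
  have h3 : (-Complex.I) ^ 3 = Complex.I := by rw [neg_pow, h2]; ring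
  have hI : Complex.I ≠ 1 := fun h => by simpa using congrArg Complex.re h
  have hI' : -Complex.I ≠ 1 := fun h => by simpa using congrArg Complex.re h
  have hn : (-1 : ℂ) ≠ 1 := by norm_num
  interval_cases k <;> interval_cases l <;>
    first
    | exact absurd rfl h
    | simpa [h2, h3] using hI
    | simpa [h2, h3] using hI'
    | simpa [h2, h3] using hn

variable [MeasurableSpace (unitaryGroup n ℂ)] [BorelSpace (unitaryGroup n ℂ)]
    (μ : Measure (unitaryGroup n ℂ)) [μ.IsHaarMeasure] [IsProbabilityMeasure μ]

/-- A right translate of `μ` is again a Haar probability measure, so it equals `μ` by uniqueness. -/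
lemma isMulRightInvariant_haar : μ.IsMulRightInvariant := ⟨fun g => by
  have : IsProbabilityMeasure (μ.map (· * g)) :=
    Measure.isProbabilityMeasure_map (measurable_mul_const g).aemeasurable
  exact Measure.isHaarMeasure_eq_of_isProbabilityMeasure _ μ⟩

omit [IsProbabilityMeasure μ] in
lemma integrable_haar_of_continuous {E : Type*} [NormedAddCommGroup E]
    {f : unitaryGroup n ℂ → E} (h : Continuous f) :
    Integrable f μ :=
  h.integrable_of_hasCompactSupport (HasCompactSupport.of_compactSpace f)

omit [IsProbabilityMeasure μ] in
/-- Averages of monomials which are unbalanced in one coordinate vanish. -/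
lemma integral_eq_zero_of_phase {f : unitaryGroup n ℂ → ℂ} {z : n} {k l : ℕ} (hk : k ≤ 3)
    (hl : l ≤ 3) (h : k ≠ l)
    (hf : ∀ U, f (phaseUnitary z * U) = Complex.I ^ k * (star Complex.I) ^ l * f U) :
    ∫ U, f U ∂μ = 0 := by
  have h1 := integral_mul_left_eq_self (μ := μ) f (phaseUnitary z)
  simp only [hf] at h1
  rw [integral_const_mul] at h1
  by_contra h0
  exact I_pow_mul_neg_I_pow_ne_one hk hl h (mul_right_cancel₀ h0 (h1.trans (one_mul _).symm))

-- For `t = 2` the reflection sends `ψ_x` to `(3 ψ_x + 4 ψ_y) / 5`, a rational mixing with `25 = 3²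
-- + 4²`. After binomial expansion of `ψ_x ^ N` and its conjugate, the phase at `x` kills all
-- off-diagonal terms, leaving a linear relation between moments.
omit [IsProbabilityMeasure μ] in
lemma integral_entrySq_pow_rotate (r : n) {x y : n} (h : x ≠ y) {N : ℕ} (hN : N ≤ 3)
    {F : unitaryGroup n ℂ → ℂ} (hF : Continuous F)
    (hF1 : ∀ U, F (reflectionUnitary h 2 * U) = F U) (hF2 : ∀ U, F (phaseUnitary x * U) = F U) :
    ∫ U, entrySq r x U ^ N * F U ∂μ =
      ∑ k ∈ Finset.range (N + 1), ((3 : ℂ) ^ k * 4 ^ (N - k) * N.choose k) ^ 2 / 25 ^ N *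
        ∫ U, entrySq r x U ^ k * entrySq r y U ^ (N - k) * F U ∂μ := by
  set m : ℕ → ℕ → unitaryGroup n ℂ → ℂ := fun k l U =>
    (U : Matrix n n ℂ) x r ^ k * (U : Matrix n n ℂ) y r ^ (N - k) *
      (star ((U : Matrix n n ℂ) x r) ^ l * star ((U : Matrix n n ℂ) y r) ^ (N - l)) * F U with hm
  have hmc : ∀ k l, Continuous (m k l) := fun k l => by simp only [hm]; fun_prop
  set c : ℕ → ℂ := fun k => (3 : ℂ) ^ k * 4 ^ (N - k) * N.choose k with hc
  have hexp : ∀ U, entrySq r x (reflectionUnitary h 2 * U) ^ N * F (reflectionUnitary h 2 * U) =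
      ∑ k ∈ Finset.range (N + 1), ∑ l ∈ Finset.range (N + 1), c k * c l / 25 ^ N * m k l U := by
    intro U
    have e1 : ((reflectionUnitary h 2 * U : unitaryGroup n ℂ) : Matrix n n ℂ) x r =
        (3 * (U : Matrix n n ℂ) x r + 4 * (U : Matrix n n ℂ) y r) / 5 := by
      rw [reflectionUnitary_mul_apply]
      simp [h]
      ring
    rw [hF1, entrySq, e1, star_div₀, star_add, star_mul', star_mul', mul_pow, div_pow, div_pow,
      add_pow, add_pow]
    have e2 : (star 5 : ℂ) = 5 ∧ (star 3 : ℂ) = 3 ∧ (star 4 : ℂ) = 4 := by simp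
    have h25 : (5 : ℂ) ^ N * 5 ^ N = 25 ^ N := by rw [← mul_pow]; norm_num
    rw [e2.1, e2.2.1, e2.2.2, div_mul_div_comm, h25, Finset.sum_mul_sum, Finset.sum_div,
      Finset.sum_mul]
    refine Finset.sum_congr rfl fun k _ => ?_
    rw [Finset.sum_div, Finset.sum_mul]
    refine Finset.sum_congr rfl fun l _ => ?_
    simp only [hc, hm, mul_pow]
    ring
  rw [← integral_mul_left_eq_self (μ := μ) _ (reflectionUnitary h 2)]
  simp only [hexp]
  rw [integral_finsetSum _ fun k _ => integrable_haar_of_continuous μ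
    (continuous_finsetSum _ fun l _ => (hmc k l).const_mul _)]
  refine Finset.sum_congr rfl fun k hk => ?_
  rw [integral_finsetSum _ fun l _ => integrable_haar_of_continuous μ ((hmc k l).const_mul _),
    Finset.sum_eq_single_of_mem k hk]
  · rw [integral_const_mul, ← pow_two]
    congr 2
    ext U
    simp only [hm, entrySq, mul_pow]
    ring
  · intro l hl hlk
    rw [integral_const_mul, integral_eq_zero_of_phase μ (z := x) (k := k) (l := l)
      (by have := Finset.mem_range.mp hk; omega) (by have := Finset.mem_range.mp hl; omega)
      hlk.symm, mul_zero]
    intro U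
    simp only [hm, phaseUnitary_mul_apply, hF2, if_true, h.symm, if_false, star_mul', mul_pow,
      one_mul]
    ring

omit [IsProbabilityMeasure μ] in
lemma integral_swap {f g : unitaryGroup n ℂ → ℂ} {x y : n} (h : x ≠ y)
    (hfg : ∀ U, f (reflectionUnitary h 1 * U) = g U) : ∫ U, f U ∂μ = ∫ U, g U ∂μ := by
  rw [← integral_mul_left_eq_self (μ := μ) f (reflectionUnitary h 1)]
  simp only [hfg]

omit [IsProbabilityMeasure μ] in
lemma integral_entrySq_cube_eq (r x y : n) :
    ∫ U, entrySq r x U ^ 3 ∂μ = ∫ U, entrySq r y U ^ 3 ∂μ := by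
  by_cases h : x = y
  · rw [h]
  · exact integral_swap μ h fun U => by simp [entrySq, reflectionUnitary_one_mul_apply]

omit [IsProbabilityMeasure μ] in
lemma integral_entrySq_sq_mul_swap (r : n) {x y : n} (h : x ≠ y) :
    ∫ U, entrySq r x U ^ 2 * entrySq r y U ∂μ = ∫ U, entrySq r y U ^ 2 * entrySq r x U ∂μ :=
  integral_swap μ h fun U => by simp [entrySq, reflectionUnitary_one_mul_apply]

-- The rotation relation with `N = 3` has two unknowns, the pure cube and the mixed moment, once the
-- swap symmetry is used. The weights are `729, 11664, 20736, 4096` over `15625`.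
omit [IsProbabilityMeasure μ] in
lemma integral_entrySq_sq_mul (r : n) {x y : n} (h : x ≠ y) :
    ∫ U, entrySq r x U ^ 2 * entrySq r y U ∂μ = (∫ U, entrySq r x U ^ 3 ∂μ) / 3 := by
  have h1 := integral_entrySq_pow_rotate μ r h (N := 3) le_rfl (F := fun _ => 1)
    continuous_const (fun _ => rfl) (fun _ => rfl)
  simp only [Finset.sum_range_succ, Finset.sum_range_zero, mul_one, pow_zero, one_mul,
    pow_one, Nat.sub_self, Nat.sub_zero, zero_add] at h1
  have h2 := integral_entrySq_sq_mul_swap μ r h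
  have h3 := integral_entrySq_cube_eq μ r y x
  simp only [show 3 - 1 = 2 from rfl, show 3 - 2 = 1 from rfl, pow_one,
    mul_comm (entrySq r x _) (entrySq r y _ ^ 2)] at h1
  rw [h3, ← h2] at h1
  norm_num [Nat.choose] at h1
  linear_combination (-15625 / 32400 : ℂ) * h1

-- The rotation relation with `N = 2` and spectator `F = |ψ_z|²`, with weights `81, 576, 256` over
-- `625`.
omit [IsProbabilityMeasure μ] in
lemma integral_entrySq_mul_mul (r : n) {x y z : n} (h : x ≠ y) (hxz : x ≠ z) (hyz : y ≠ z) :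
    ∫ U, entrySq r x U * entrySq r y U * entrySq r z U ∂μ = (∫ U, entrySq r x U ^ 3 ∂μ) / 6 := by
  have h1 := integral_entrySq_pow_rotate μ r h (N := 2) (by norm_num) (F := entrySq r z)
    (continuous_entrySq r z)
    (fun U => by simp [entrySq, reflectionUnitary_mul_apply, hxz.symm, hyz.symm])
    (fun U => by simp [entrySq, phaseUnitary_mul_apply, hxz.symm])
  simp only [Finset.sum_range_succ, Finset.sum_range_zero, mul_one, pow_zero, one_mul,
    pow_one, Nat.sub_self, Nat.sub_zero, zero_add, show 2 - 1 = 1 from rfl] at h1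
  rw [integral_entrySq_sq_mul μ r hxz, integral_entrySq_sq_mul μ r hyz,
    integral_entrySq_cube_eq μ r y x] at h1
  norm_num [Nat.choose] at h1
  linear_combination (-625 / 576 : ℂ) * h1

end HaarUnitary

/-! ### Sixth and fourth moments of a Haar-random column -/

section HaarMoments

variable {n : Type*} [Fintype n] [DecidableEq n]

/-- The monomial `ψ_{p₁} ψ_{p₂} ψ_{p₃} ψ̄_{q₁} ψ̄_{q₂} ψ̄_{q₃}` in the entries of the column
`ψ = U e_r`. -/
noncomputable def columnMonomial (r p₁ p₂ p₃ q₁ q₂ q₃ : n) (U : unitaryGroup n ℂ) : ℂ :=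
  (U : Matrix n n ℂ) p₁ r * (U : Matrix n n ℂ) p₂ r * (U : Matrix n n ℂ) p₃ r *
    (star ((U : Matrix n n ℂ) q₁ r) * star ((U : Matrix n n ℂ) q₂ r) *
      star ((U : Matrix n n ℂ) q₃ r))

@[fun_prop]
lemma continuous_columnMonomial (r p₁ p₂ p₃ q₁ q₂ q₃ : n) :
    Continuous (columnMonomial r p₁ p₂ p₃ q₁ q₂ q₃) := by
  unfold columnMonomial
  fun_prop

/-- The number of permutations matching `(p₁, p₂, p₃)` with `(q₁, q₂, q₃)`. -/
def matchings (p₁ p₂ p₃ q₁ q₂ q₃ : n) : ℂ :=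
  (if p₁ = q₁ then if p₂ = q₂ then if p₃ = q₃ then 1 else 0 else 0 else 0) +
  (if p₁ = q₁ then if p₂ = q₃ then if p₃ = q₂ then 1 else 0 else 0 else 0) +
  (if p₁ = q₂ then if p₂ = q₁ then if p₃ = q₃ then 1 else 0 else 0 else 0) +
  (if p₁ = q₂ then if p₂ = q₃ then if p₃ = q₁ then 1 else 0 else 0 else 0) +
  (if p₁ = q₃ then if p₂ = q₁ then if p₃ = q₂ then 1 else 0 else 0 else 0) +
  (if p₁ = q₃ then if p₂ = q₂ then if p₃ = q₁ then 1 else 0 else 0 else 0)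

omit [Fintype n] in
lemma matchings_eq_zero_of_count_ne {z p₁ p₂ p₃ q₁ q₂ q₃ : n}
    (h : [p₁, p₂, p₃].count z ≠ [q₁, q₂, q₃].count z) : matchings p₁ p₂ p₃ q₁ q₂ q₃ = 0 := by
  have key : ∀ a b c : n, [a, b, c].Perm [q₁, q₂, q₃] →
      (if p₁ = a then if p₂ = b then if p₃ = c then (1 : ℂ) else 0 else 0 else 0) = 0 := by
    intro a b c hp
    split_ifs with h1 h2 h3 <;> try rfl
    subst h1 h2 h3
    exact absurd (hp.count_eq z) h
  rw [matchings, key _ _ _ (.refl _), key _ _ _ (.cons _ (.swap _ _ _)), key _ _ _ (.swap _ _ _),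
    key q₂ q₃ q₁ (List.perm_append_comm (l₁ := [q₂, q₃]) (l₂ := [q₁])),
    key q₃ q₁ q₂ (List.perm_append_comm (l₁ := [q₃]) (l₂ := [q₁, q₂])),
    key q₃ q₂ q₁ (List.reverse_perm [q₁, q₂, q₃])]
  simp

omit [Fintype n] in
lemma prod_ite_eq_pow_count (c : ℂ) (z a b d : n) :
    (if a = z then c else 1) * (if b = z then c else 1) * (if d = z then c else 1) =
      c ^ [a, b, d].count z := by
  simp only [List.count_cons, List.count_nil, beq_iff_eq]
  split_ifs <;> ring

lemma columnMonomial_phase (r z p₁ p₂ p₃ q₁ q₂ q₃ : n) (U : unitaryGroup n ℂ) :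
    columnMonomial r p₁ p₂ p₃ q₁ q₂ q₃ (phaseUnitary z * U) =
      Complex.I ^ [p₁, p₂, p₃].count z * (star Complex.I) ^ [q₁, q₂, q₃].count z *
        columnMonomial r p₁ p₂ p₃ q₁ q₂ q₃ U := by
  have h : ∀ q : n, star (if q = z then Complex.I else 1) =
      if q = z then star Complex.I else 1 := by
    intro q; split_ifs <;> simp
  simp only [columnMonomial, phaseUnitary_mul_apply, ← prod_ite_eq_pow_count, star_mul', h]
  ring

lemma sum_column_mul_star (U : unitaryGroup n ℂ) (r s : n) :
    ∑ z, (U : Matrix n n ℂ) z r * star ((U : Matrix n n ℂ) z s) = if r = s then 1 else 0 := by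
  have h := congrFun (congrFun (unitary_conjTranspose_mul U) s) r
  rw [Matrix.mul_apply, one_apply] at h
  simp only [conjTranspose_apply, mul_comm (star _)] at h
  rw [h]
  simp only [eq_comm]

lemma sum_row_mul_star (U : unitaryGroup n ℂ) (p q : n) :
    ∑ z, (U : Matrix n n ℂ) p z * star ((U : Matrix n n ℂ) q z) = if p = q then 1 else 0 := by
  have h := congrFun (congrFun (unitary_mul_conjTranspose U) p) q
  rwa [Matrix.mul_apply, one_apply] at h

variable [MeasurableSpace (unitaryGroup n ℂ)] [BorelSpace (unitaryGroup n ℂ)]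
    (μ : Measure (unitaryGroup n ℂ)) [μ.IsHaarMeasure]

lemma integral_sum_haar {ι : Type*} [Fintype ι] {f : ι → unitaryGroup n ℂ → ℂ}
    (hf : ∀ i, Continuous (f i)) : ∫ U, ∑ i, f i U ∂μ = ∑ i, ∫ U, f i U ∂μ :=
  integral_finsetSum _ fun i _ => integrable_haar_of_continuous μ (hf i)

/-- Three, two or no coinciding indices give `6`, `2` or `1` matchings, in proportion to the moments
`M`, `M / 3`, `M / 6` with `M` the sixth moment of one entry. -/
lemma integral_columnMonomial_self (r p₁ p₂ p₃ : n) :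
    ∫ U, columnMonomial r p₁ p₂ p₃ p₁ p₂ p₃ U ∂μ =
      (∫ U, entrySq r r U ^ 3 ∂μ) / 6 * matchings p₁ p₂ p₃ p₁ p₂ p₃ := by
  have e : ∀ U, columnMonomial r p₁ p₂ p₃ p₁ p₂ p₃ U =
      entrySq r p₁ U * entrySq r p₂ U * entrySq r p₃ U := fun U => by
    simp only [columnMonomial, entrySq]; ring
  simp only [e]
  rw [← integral_entrySq_cube_eq μ r p₁ r]
  by_cases h12 : p₁ = p₂
  · subst h12
    by_cases h13 : p₁ = p₃
    · subst h13
      have : ∀ U, entrySq r p₁ U * entrySq r p₁ U * entrySq r p₁ U = entrySq r p₁ U ^ 3 :=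
        fun U => by ring
      simp only [this, matchings, if_true]
      ring
    · simp only [← pow_two]
      rw [integral_entrySq_sq_mul μ r h13]
      simp only [matchings, if_true, h13, Ne.symm h13, if_false]
      ring
  · by_cases h13 : p₁ = p₃
    · subst h13
      have : ∀ U, entrySq r p₁ U * entrySq r p₂ U * entrySq r p₁ U =
          entrySq r p₁ U ^ 2 * entrySq r p₂ U := fun U => by ring
      simp only [this]
      rw [integral_entrySq_sq_mul μ r h12]
      simp only [matchings, if_true, h12, Ne.symm h12, if_false]
      ring
    · by_cases h23 : p₂ = p₃
      · subst h23
        have : ∀ U, entrySq r p₁ U * entrySq r p₂ U * entrySq r p₂ U =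
            entrySq r p₂ U ^ 2 * entrySq r p₁ U := fun U => by ring
        simp only [this]
        rw [integral_entrySq_sq_mul μ r (Ne.symm h12), integral_entrySq_cube_eq μ r p₂ p₁]
        simp only [matchings, if_true, h12, Ne.symm h12, if_false]
        ring
      · rw [integral_entrySq_mul_mul μ r h12 h13 h23]
        simp only [matchings, if_true, h12, h13, h23, Ne.symm h12, Ne.symm h13, Ne.symm h23,
          if_false]
        ring

/-- If some index occurs unequally often among the `p`'s and the `q`'s, a phase kills both sides.
Otherwise the `q`'s are a permutation of the `p`'s, and symmetry reduces to the diagonal case. -/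
lemma integral_columnMonomial_eq_mul_matchings (r p₁ p₂ p₃ q₁ q₂ q₃ : n) :
    ∫ U, columnMonomial r p₁ p₂ p₃ q₁ q₂ q₃ U ∂μ =
      (∫ U, entrySq r r U ^ 3 ∂μ) / 6 * matchings p₁ p₂ p₃ q₁ q₂ q₃ := by
  by_cases h : ∃ z, [p₁, p₂, p₃].count z ≠ [q₁, q₂, q₃].count z
  · obtain ⟨z, hz⟩ := h
    rw [matchings_eq_zero_of_count_ne hz, mul_zero]
    exact integral_eq_zero_of_phase μ List.count_le_length List.count_le_length hz
      (columnMonomial_phase r z p₁ p₂ p₃ q₁ q₂ q₃)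
  · push Not at h
    have hp : [q₁, q₂, q₃] ∈ [p₁, p₂, p₃].permutations :=
      List.mem_permutations.mpr (List.perm_iff_count.mpr fun z => (h z).symm)
    have hl : [p₁, p₂, p₃].permutations = [[p₁, p₂, p₃], [p₂, p₁, p₃], [p₃, p₂, p₁], [p₂, p₃, p₁],
        [p₃, p₁, p₂], [p₁, p₃, p₂]] := by
      simp [List.permutations, List.permutationsAux, List.permutationsAux.rec,
        List.permutationsAux2]
    have hself := integral_columnMonomial_self μ r p₁ p₂ p₃
    have hc : ∀ a b c, matchings p₁ p₂ p₃ a b c = matchings p₁ p₂ p₃ p₁ p₂ p₃ →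
        (∀ U, columnMonomial r p₁ p₂ p₃ a b c U = columnMonomial r p₁ p₂ p₃ p₁ p₂ p₃ U) →
        ∫ U, columnMonomial r p₁ p₂ p₃ a b c U ∂μ =
          (∫ U, entrySq r r U ^ 3 ∂μ) / 6 * matchings p₁ p₂ p₃ a b c := by
      intro a b c h1 h2
      simp only [h2, h1, hself]
    rw [hl] at hp
    simp only [List.mem_cons, List.cons.injEq, and_true, List.not_mem_nil, or_false] at hp
    rcases hp with ⟨rfl, rfl, rfl⟩ | ⟨rfl, rfl, rfl⟩ | ⟨rfl, rfl, rfl⟩ | ⟨rfl, rfl, rfl⟩ |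
      ⟨rfl, rfl, rfl⟩ | ⟨rfl, rfl, rfl⟩ <;>
    exact hc _ _ _ (by unfold matchings; ring) (fun U => by unfold columnMonomial; ring)

variable [IsProbabilityMeasure μ]

/-- The normalisation comes from integrating `(∑ |ψ_p|²)³ = 1` and counting all matchings. -/
lemma integral_entrySq_cube_div (r : n) :
    (∫ U, entrySq r r U ^ 3 ∂μ) / 6 =
      ((Fintype.card n : ℂ) * (Fintype.card n + 1) * (Fintype.card n + 2))⁻¹ := by
  have h1 : ∀ U : unitaryGroup n ℂ,
      ∑ p₁, ∑ p₂, ∑ p₃, columnMonomial r p₁ p₂ p₃ p₁ p₂ p₃ U = 1 := by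
    intro U
    have : ∀ p₁ p₂ p₃, columnMonomial r p₁ p₂ p₃ p₁ p₂ p₃ U =
      (U : Matrix n n ℂ) p₁ r * star ((U : Matrix n n ℂ) p₁ r) *
      ((U : Matrix n n ℂ) p₂ r * star ((U : Matrix n n ℂ) p₂ r) *
      ((U : Matrix n n ℂ) p₃ r * star ((U : Matrix n n ℂ) p₃ r))) := fun _ _ _ => by
        simp only [columnMonomial]; ring
    simp only [this, ← Finset.mul_sum, sum_column_mul_star, if_true, mul_one]
  have h2 : ∫ U : unitaryGroup n ℂ,
      ∑ p₁, ∑ p₂, ∑ p₃, columnMonomial r p₁ p₂ p₃ p₁ p₂ p₃ U ∂μ = 1 := by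
    simp [h1]
  simp (disch := intros; fun_prop) only [integral_sum_haar] at h2
  simp only [integral_columnMonomial_eq_mul_matchings, ← Finset.mul_sum] at h2
  have h3 : ∑ p₁ : n, ∑ p₂ : n, ∑ p₃ : n, matchings p₁ p₂ p₃ p₁ p₂ p₃ =
      (Fintype.card n : ℂ) * (Fintype.card n + 1) * (Fintype.card n + 2) := by
    simp only [matchings, if_true, Finset.sum_add_distrib]
    simp
    ring
  rw [h3] at h2
  exact eq_inv_of_mul_eq_one_left h2

lemma integral_columnMonomial (r p₁ p₂ p₃ q₁ q₂ q₃ : n) :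
    ∫ U, columnMonomial r p₁ p₂ p₃ q₁ q₂ q₃ U ∂μ =
      ((Fintype.card n : ℂ) * (Fintype.card n + 1) * (Fintype.card n + 2))⁻¹ *
        matchings p₁ p₂ p₃ q₁ q₂ q₃ := by
  rw [integral_columnMonomial_eq_mul_matchings, integral_entrySq_cube_div]

/-- Obtained from the sixth moments by inserting `∑_z |ψ_z|² = 1`. -/
lemma integral_column_quartic (r p₁ p₂ q₁ q₂ : n) :
    ∫ U : unitaryGroup n ℂ, (U : Matrix n n ℂ) p₁ r * (U : Matrix n n ℂ) p₂ r *
        (star ((U : Matrix n n ℂ) q₁ r) * star ((U : Matrix n n ℂ) q₂ r)) ∂μ =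
      ((Fintype.card n : ℂ) * (Fintype.card n + 1))⁻¹ *
        ((if p₁ = q₁ then if p₂ = q₂ then 1 else 0 else 0) +
          (if p₁ = q₂ then if p₂ = q₁ then 1 else 0 else 0)) := by
  have h1 : ∀ U : unitaryGroup n ℂ, (U : Matrix n n ℂ) p₁ r * (U : Matrix n n ℂ) p₂ r *
        (star ((U : Matrix n n ℂ) q₁ r) * star ((U : Matrix n n ℂ) q₂ r)) =
      ∑ z, columnMonomial r p₁ p₂ z q₁ q₂ z U := by
    intro U
    have : ∀ z, columnMonomial r p₁ p₂ z q₁ q₂ z U =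
      (U : Matrix n n ℂ) p₁ r * (U : Matrix n n ℂ) p₂ r *
        (star ((U : Matrix n n ℂ) q₁ r) * star ((U : Matrix n n ℂ) q₂ r)) *
      ((U : Matrix n n ℂ) z r * star ((U : Matrix n n ℂ) z r)) := fun _ => by
        simp only [columnMonomial]; ring
    simp only [this, ← Finset.mul_sum, sum_column_mul_star, if_true, mul_one]
  simp only [h1]
  rw [integral_sum_haar μ fun z => by fun_prop]
  simp only [integral_columnMonomial, ← Finset.mul_sum]
  have h2 : ∑ z, matchings p₁ p₂ z q₁ q₂ z = ((Fintype.card n : ℂ) + 2) *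
      ((if p₁ = q₁ then if p₂ = q₂ then 1 else 0 else 0) +
          (if p₁ = q₂ then if p₂ = q₁ then 1 else 0 else 0)) := by
    simp only [matchings, if_true, Finset.sum_add_distrib]
    have e1 : ∀ a b c d : n, ∑ z : n,
        (if a = z then if b = c then if z = d then (1 : ℂ) else 0 else 0 else 0) =
        if a = d then if b = c then 1 else 0 else 0 := by
      intro a b c d
      rw [Finset.sum_ite_eq]
      split_ifs <;> simp_all
    have e2 : ∀ a b c d : n, ∑ z : n,
        (if a = b then if c = z then if z = d then (1 : ℂ) else 0 else 0 else 0) =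
        if a = b then if c = d then 1 else 0 else 0 := by
      intro a b c d
      split_ifs <;> simp_all
    have e3 : ∀ a b c d : n, ∑ z : n,
        (if a = b then if c = d then (1 : ℂ) else 0 else 0) =
        (Fintype.card n : ℂ) * if a = b then if c = d then (1 : ℂ) else 0 else 0 := by
      intro a b c d
      simp
    simp only [e1, e2, e3]
    ring
  rw [h2]
  have hd : (Fintype.card n : ℂ) + 2 ≠ 0 := by
    exact_mod_cast (Nat.succ_ne_zero (Fintype.card n + 1))
  field_simp

end HaarMoments

/-! ### Average overlaps and the origin of `σ` -/

section Overlap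

variable {a b : Type*} [Fintype a] [DecidableEq a] [Fintype b] [DecidableEq b]

/-- Each of the six permutations contributes one monomial in the dimensions, its exponents counting
the index loops left after contraction. -/
lemma sum_matchings_overlap :
    ∑ i : a, ∑ j : b, ∑ k : a, ∑ l : b, ∑ n : a, ∑ m : b,
      matchings (i, m) (n, j) (k, l) (k, m) (n, l) (i, j) =
    (Fintype.card a : ℂ) * Fintype.card b * (3 * (Fintype.card a * Fintype.card b) +
      Fintype.card a ^ 2 + Fintype.card b ^ 2 + 1) := by
  simp only [matchings, Prod.mk.injEq, ite_and, if_true, Finset.sum_add_distrib]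
  simp [Finset.sum_ite_irrel]
  ring

/-- The projection onto the `r`-th column of a unitary matrix. -/
noncomputable def columnProjection {n : Type*} [Fintype n] [DecidableEq n] (U : unitaryGroup n ℂ)
    (r : n) : Matrix n n ℂ :=
  of fun x y => (U : Matrix n n ℂ) x r * star ((U : Matrix n n ℂ) y r)

lemma sum_columnProjection {n : Type*} [Fintype n] [DecidableEq n] (U : unitaryGroup n ℂ) :
    ∑ r, columnProjection U r = 1 := by
  ext x y
  rw [Matrix.sum_apply, one_apply, ← sum_row_mul_star U x y]
  rfl

lemma trace_columnProjection {n : Type*} [Fintype n] [DecidableEq n] (U : unitaryGroup n ℂ)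
    (r : n) : (columnProjection U r).trace = 1 := by
  have := sum_column_mul_star U r r
  rwa [if_pos rfl] at this

lemma spectralMatrix_eq_sum_columnProjection {n : Type*} [Fintype n] [DecidableEq n]
    (U : unitaryGroup n ℂ) (x : n → ℝ) :
    spectralMatrix U x = ∑ r, (x r : ℂ) • columnProjection U r := by
  ext p q
  rw [spectralMatrix, Matrix.mul_apply, Matrix.sum_apply]
  refine Finset.sum_congr rfl fun r _ => ?_
  rw [mul_diagonal, Matrix.smul_apply, conjTranspose_apply, columnProjection, of_apply,
    smul_eq_mul]
  ring

omit [Fintype a] [DecidableEq a] [DecidableEq b] in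
lemma reducedA_sum_smul {ι : Type*} [Fintype ι] (c : ι → ℂ) (M : ι → Matrix (a × b) (a × b) ℂ) :
    reducedA (∑ r, c r • M r) = ∑ r, c r • reducedA (M r) := by
  ext i k
  simp only [reducedA, of_apply, Matrix.sum_apply, Matrix.smul_apply, smul_eq_mul, Finset.mul_sum]
  exact Finset.sum_comm

omit [DecidableEq a] [Fintype b] [DecidableEq b] in
lemma reducedB_sum_smul {ι : Type*} [Fintype ι] (c : ι → ℂ) (M : ι → Matrix (a × b) (a × b) ℂ) :
    reducedB (∑ r, c r • M r) = ∑ r, c r • reducedB (M r) := by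
  ext i k
  simp only [reducedB, of_apply, Matrix.sum_apply, Matrix.smul_apply, smul_eq_mul, Finset.mul_sum]
  exact Finset.sum_comm

omit [Fintype a] in
lemma reducedA_one : reducedA (1 : Matrix (a × b) (a × b) ℂ) = (Fintype.card b : ℂ) • 1 := by
  ext i k
  by_cases h : i = k <;> simp [reducedA, one_apply, h]

omit [Fintype b] in
lemma reducedB_one : reducedB (1 : Matrix (a × b) (a × b) ℂ) = (Fintype.card a : ℂ) • 1 := by
  ext i k
  by_cases h : i = k <;> simp [reducedB, one_apply, h]

/-- `Tr ((Tr_B P_r ⊗ Tr_A P_s) P_p)` for the projections `P` onto the columns of `U`. -/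
noncomputable def marginalOverlap (r s p : a × b) (U : unitaryGroup (a × b) ℂ) : ℂ :=
  ((reducedA (columnProjection U r) ⊗ₖ reducedB (columnProjection U s)) *
    columnProjection U p).trace

lemma marginalOverlap_eq_sum (r s p : a × b) (U : unitaryGroup (a × b) ℂ) :
    marginalOverlap r s p U = ∑ i : a, ∑ j : b, ∑ k : a, ∑ l : b, ∑ n : a, ∑ m : b,
      (U : Matrix (a × b) (a × b) ℂ) (i, m) r * star ((U : Matrix (a × b) (a × b) ℂ) (k, m) r) *
      ((U : Matrix (a × b) (a × b) ℂ) (n, j) s * star ((U : Matrix (a × b) (a × b) ℂ) (n, l) s)) *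
      ((U : Matrix (a × b) (a × b) ℂ) (k, l) p *
        star ((U : Matrix (a × b) (a × b) ℂ) (i, j) p)) := by
  simp only [marginalOverlap, Matrix.trace, diag_apply, Matrix.mul_apply, Fintype.sum_prod_type,
    kroneckerMap_apply, reducedA, reducedB, of_apply, columnProjection, Finset.sum_mul,
    Finset.mul_sum]

@[fun_prop]
lemma continuous_marginalOverlap (r s p : a × b) : Continuous (marginalOverlap r s p) := by
  simp only [funext (marginalOverlap_eq_sum r s p)]
  fun_prop

lemma sum_marginalOverlap (r s : a × b) (U : unitaryGroup (a × b) ℂ) :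
    ∑ p, marginalOverlap r s p U = 1 := by
  simp only [marginalOverlap]
  rw [← trace_sum, ← Finset.mul_sum, sum_columnProjection, Matrix.mul_one, trace_kronecker,
    trace_reducedA, trace_reducedB, trace_columnProjection, trace_columnProjection, mul_one]

/-- Summing the projections over `s` gives `Tr_A 1 = d_A 1`, which collapses the overlap to one
between `A`-marginals. -/
lemma sum_marginalOverlap_snd (r p : a × b) (U : unitaryGroup (a × b) ℂ) :
    ∑ s, marginalOverlap r s p U = Fintype.card a *
      (reducedA (columnProjection U r) * reducedA (columnProjection U p)).trace := by
  have h := reducedB_sum_smul (fun _ : a × b => (1 : ℂ)) (columnProjection U)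
  simp only [one_smul, sum_columnProjection, reducedB_one] at h
  simp only [marginalOverlap]
  rw [← trace_sum, ← Finset.sum_mul]
  have h2 : ∑ s, reducedA (columnProjection U r) ⊗ₖ reducedB (columnProjection U s) =
      reducedA (columnProjection U r) ⊗ₖ ∑ s, reducedB (columnProjection U s) := by
    ext x y
    simp [Matrix.sum_apply, Finset.mul_sum]
  rw [h2, ← h, kronecker_smul, Matrix.smul_mul, trace_smul, trace_kronecker_one_mul, smul_eq_mul]

lemma sum_marginalOverlap_fst (s p : a × b) (U : unitaryGroup (a × b) ℂ) :
    ∑ r, marginalOverlap r s p U = Fintype.card b *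
      (reducedB (columnProjection U s) * reducedB (columnProjection U p)).trace := by
  have h := reducedA_sum_smul (fun _ : a × b => (1 : ℂ)) (columnProjection U)
  simp only [one_smul, sum_columnProjection, reducedA_one] at h
  simp only [marginalOverlap]
  rw [← trace_sum, ← Finset.sum_mul]
  have h2 : ∑ r, reducedA (columnProjection U r) ⊗ₖ reducedB (columnProjection U s) =
      (∑ r, reducedA (columnProjection U r)) ⊗ₖ reducedB (columnProjection U s) := by
    ext x y
    simp [Matrix.sum_apply, Finset.sum_mul]
  rw [h2, ← h, smul_kronecker, Matrix.smul_mul, trace_smul, trace_one_kronecker_mul, smul_eq_mul]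

lemma trace_spectralMatrix_mul_kronecker (W : unitaryGroup (a × b) ℂ) (x g : a × b → ℝ) :
    (spectralMatrix W g *
      (reducedA (spectralMatrix W x) ⊗ₖ reducedB (spectralMatrix W x))).trace =
      ∑ p, ∑ r, ∑ s, (g p * x r * x s : ℂ) * marginalOverlap r s p W := by
  rw [trace_mul_comm, spectralMatrix_eq_sum_columnProjection W g,
    spectralMatrix_eq_sum_columnProjection W x, reducedA_sum_smul, reducedB_sum_smul,
    Finset.mul_sum, trace_sum]
  refine Finset.sum_congr rfl fun p _ => ?_
  have h2 : (∑ r, (x r : ℂ) • reducedA (columnProjection W r)) ⊗ₖ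
      (∑ s, (x s : ℂ) • reducedB (columnProjection W s)) =
      ∑ r, ∑ s, (x r * x s : ℂ) •
        (reducedA (columnProjection W r) ⊗ₖ reducedB (columnProjection W s)) := by
    ext y z
    simp only [kroneckerMap_apply, Matrix.sum_apply, Matrix.smul_apply, smul_eq_mul,
      Finset.sum_mul_sum]
    refine Finset.sum_congr rfl fun r _ => Finset.sum_congr rfl fun s _ => by ring
  rw [h2, Finset.sum_mul, trace_sum]
  refine Finset.sum_congr rfl fun r _ => ?_
  rw [Finset.sum_mul, trace_sum]
  refine Finset.sum_congr rfl fun s _ => ?_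
  rw [Matrix.smul_mul, Matrix.mul_smul, smul_smul, trace_smul, marginalOverlap, smul_eq_mul]
  ring

lemma marginalOverlap_mul_reflection {x y : a × b} (h : x ≠ y) (r s p : a × b)
    (U : unitaryGroup (a × b) ℂ) :
    marginalOverlap r s p (U * reflectionUnitary h 1) =
      marginalOverlap (Equiv.swap x y r) (Equiv.swap x y s) (Equiv.swap x y p) U := by
  have : ∀ q, columnProjection (U * reflectionUnitary h 1) q =
      columnProjection U (Equiv.swap x y q) := by
    intro q
    ext z w
    simp only [columnProjection, of_apply, mul_reflectionUnitary_one_apply]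
  simp only [marginalOverlap, this]

variable [MeasurableSpace (unitaryGroup (a × b) ℂ)] [BorelSpace (unitaryGroup (a × b) ℂ)]
    (μ : Measure (unitaryGroup (a × b) ℂ)) [μ.IsHaarMeasure] [IsProbabilityMeasure μ]

lemma integral_marginalOverlap_swap (x y r s p : a × b) :
    ∫ U, marginalOverlap (Equiv.swap x y r) (Equiv.swap x y s) (Equiv.swap x y p) U ∂μ =
      ∫ U, marginalOverlap r s p U ∂μ := by
  by_cases h : x = y
  · simp [h]
  have := isMulRightInvariant_haar μ
  rw [← integral_mul_right_eq_self (μ := μ) (marginalOverlap r s p) (reflectionUnitary h 1)]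
  simp only [marginalOverlap_mul_reflection]

lemma integral_marginalOverlap_self (r : a × b) :
    ∫ U, marginalOverlap r r r U ∂μ =
      (3 * (Fintype.card a * Fintype.card b) + Fintype.card a ^ 2 + Fintype.card b ^ 2 + 1) /
      (((Fintype.card a * Fintype.card b : ℂ) + 1) * (Fintype.card a * Fintype.card b + 2)) := by
  have e : ∀ U, marginalOverlap r r r U =
      ∑ i : a, ∑ j : b, ∑ k : a, ∑ l : b, ∑ n : a, ∑ m : b,
        columnMonomial r (i, m) (n, j) (k, l) (k, m) (n, l) (i, j) U := by
    intro U
    rw [marginalOverlap_eq_sum]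
    iterate 6 refine Finset.sum_congr rfl fun _ _ => ?_
    simp only [columnMonomial]
    ring
  simp only [e]
  simp (disch := intros; fun_prop) only [integral_sum_haar]
  simp only [integral_columnMonomial, ← Finset.mul_sum, sum_matchings_overlap, Fintype.card_prod,
    Nat.cast_mul]
  have ha : (Fintype.card a : ℂ) ≠ 0 := by
    have : Nonempty a := ⟨r.1⟩
    exact_mod_cast Fintype.card_ne_zero
  have hb : (Fintype.card b : ℂ) ≠ 0 := by
    have : Nonempty b := ⟨r.2⟩
    exact_mod_cast Fintype.card_ne_zero
  rw [inv_mul_eq_div, mul_assoc ((Fintype.card a : ℂ) * Fintype.card b),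
    mul_div_mul_left _ _ (mul_ne_zero ha hb)]

/-- This is the mean purity of a marginal of a random pure state; the two pairings of the fourth
moment give the two summands of the numerator. -/
lemma integral_trace_sq_reducedA (r : a × b) :
    ∫ U, (reducedA (columnProjection U r) * reducedA (columnProjection U r)).trace ∂μ =
      (Fintype.card a + Fintype.card b) / ((Fintype.card a * Fintype.card b : ℂ) + 1) := by
  have e : ∀ U : unitaryGroup (a × b) ℂ,
      (reducedA (columnProjection U r) * reducedA (columnProjection U r)).trace =
      ∑ i : a, ∑ k : a, ∑ m : b, ∑ j : b, (U : Matrix (a × b) (a × b) ℂ) (i, m) r *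
        (U : Matrix (a × b) (a × b) ℂ) (k, j) r * (star ((U : Matrix (a × b) (a × b) ℂ) (k, m) r) *
        star ((U : Matrix (a × b) (a × b) ℂ) (i, j) r)) := by
    intro U
    simp only [Matrix.trace, diag_apply, Matrix.mul_apply, reducedA, of_apply, columnProjection,
      Finset.sum_mul_sum]
    iterate 4 refine Finset.sum_congr rfl fun _ _ => ?_
    ring
  simp only [e]
  simp (disch := intros; fun_prop) only [integral_sum_haar]
  have h : ∑ i : a, ∑ k : a, ∑ m : b, ∑ j : b,
      (((if (i, m) = (k, m) then if (k, j) = (i, j) then 1 else 0 else 0) +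
        (if (i, m) = (i, j) then if (k, j) = (k, m) then 1 else 0 else 0)) : ℂ) =
      (Fintype.card a : ℂ) * Fintype.card b * (Fintype.card a + Fintype.card b) := by
    simp only [Prod.mk.injEq, ite_and, if_true, Finset.sum_add_distrib]
    simp [Finset.sum_ite_irrel]
    ring
  simp only [integral_column_quartic, ← Finset.mul_sum, h, Fintype.card_prod, Nat.cast_mul]
  have ha : (Fintype.card a : ℂ) ≠ 0 := by
    have : Nonempty a := ⟨r.1⟩
    exact_mod_cast Fintype.card_ne_zero
  have hb : (Fintype.card b : ℂ) ≠ 0 := by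
    have : Nonempty b := ⟨r.2⟩
    exact_mod_cast Fintype.card_ne_zero
  rw [inv_mul_eq_div, mul_div_mul_left _ _ (mul_ne_zero ha hb)]

lemma integral_trace_sq_reducedB (r : a × b) :
    ∫ U, (reducedB (columnProjection U r) * reducedB (columnProjection U r)).trace ∂μ =
      (Fintype.card a + Fintype.card b) / ((Fintype.card a * Fintype.card b : ℂ) + 1) := by
  have e : ∀ U : unitaryGroup (a × b) ℂ,
      (reducedB (columnProjection U r) * reducedB (columnProjection U r)).trace =
      (reducedA (columnProjection U r) * reducedA (columnProjection U r)).trace := by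
    intro U
    simp only [Matrix.trace, diag_apply, Matrix.mul_apply, reducedA, reducedB, of_apply,
      columnProjection, Finset.sum_mul_sum]
    simp only [← Fintype.sum_prod_type']
    -- Both purities are the same fourfold sum with the roles of the two index pairs exchanged.
    exact Fintype.sum_equiv ⟨fun x => (x.2.2.1, x.2.2.2, x.1, x.2.1),
      fun x => (x.2.2.1, x.2.2.2, x.1, x.2.1), fun _ => rfl, fun _ => rfl⟩ _ _ fun x => by
        simp only [Equiv.coe_fn_mk]; ring
  simp only [e, integral_trace_sq_reducedA]

/-- The average overlap depends only on which of the three columns coincide. -/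
lemma integral_marginalOverlap_congr_third (r s : a × b) {p q : a × b} (hp : r ≠ p) (hp' : s ≠ p)
    (hq : r ≠ q) (hq' : s ≠ q) :
    ∫ U, marginalOverlap r s p U ∂μ = ∫ U, marginalOverlap r s q U ∂μ := by
  have := integral_marginalOverlap_swap μ p q r s p
  rwa [Equiv.swap_apply_left, Equiv.swap_apply_of_ne_of_ne hp hq,
    Equiv.swap_apply_of_ne_of_ne hp' hq', eq_comm] at this

lemma integral_marginalOverlap_congr_second (r p : a × b) {s q : a × b} (hs : r ≠ s) (hs' : p ≠ s)
    (hq : r ≠ q) (hq' : p ≠ q) :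
    ∫ U, marginalOverlap r s p U ∂μ = ∫ U, marginalOverlap r q p U ∂μ := by
  have := integral_marginalOverlap_swap μ s q r s p
  rwa [Equiv.swap_apply_left, Equiv.swap_apply_of_ne_of_ne hs hq,
    Equiv.swap_apply_of_ne_of_ne hs' hq', eq_comm] at this

lemma integral_marginalOverlap_congr_first (s p : a × b) {r q : a × b} (hr : s ≠ r) (hr' : p ≠ r)
    (hq : s ≠ q) (hq' : p ≠ q) :
    ∫ U, marginalOverlap r s p U ∂μ = ∫ U, marginalOverlap q s p U ∂μ := by
  have := integral_marginalOverlap_swap μ r q r s p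
  rwa [Equiv.swap_apply_left, Equiv.swap_apply_of_ne_of_ne hr hq,
    Equiv.swap_apply_of_ne_of_ne hr' hq', eq_comm] at this

lemma sum_integral_marginalOverlap (r s : a × b) :
    ∑ p, ∫ U, marginalOverlap r s p U ∂μ = 1 := by
  rw [← integral_sum_haar μ fun p => by fun_prop]
  simp [sum_marginalOverlap]

lemma sum_integral_marginalOverlap_snd (r : a × b) :
    ∑ s, ∫ U, marginalOverlap r s r U ∂μ = Fintype.card a *
      ((Fintype.card a + Fintype.card b) / ((Fintype.card a * Fintype.card b : ℂ) + 1)) := by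
  rw [← integral_sum_haar μ fun p => by fun_prop]
  simp only [sum_marginalOverlap_snd]
  rw [integral_const_mul, integral_trace_sq_reducedA]

lemma sum_integral_marginalOverlap_fst (s : a × b) :
    ∑ r, ∫ U, marginalOverlap r s s U ∂μ = Fintype.card b *
      ((Fintype.card a + Fintype.card b) / ((Fintype.card a * Fintype.card b : ℂ) + 1)) := by
  rw [← integral_sum_haar μ fun p => by fun_prop]
  simp only [sum_marginalOverlap_fst]
  rw [integral_const_mul, integral_trace_sq_reducedB]

lemma sum_eq_add_card_sub_one_mul {n : Type*} [Fintype n] [DecidableEq n] {f : n → ℂ} {r k : n}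
    (hf : ∀ x, x ≠ r → f x = f k) :
    ∑ x, f x = f r + ((Fintype.card n : ℂ) - 1) * f k := by
  rw [← Finset.add_sum_erase _ _ (Finset.mem_univ r),
    Finset.sum_congr rfl fun x hx => hf x (Finset.ne_of_mem_erase hx), Finset.sum_const,
    Finset.card_erase_of_mem (Finset.mem_univ r), Finset.card_univ, nsmul_eq_mul,
    Nat.cast_sub (Fintype.card_pos_iff.mpr ⟨r⟩), Nat.cast_one]

omit [DecidableEq a] [DecidableEq b] in
lemma overlap_coefficients (ha : 2 ≤ Fintype.card a) (hb : 2 ≤ Fintype.card b) :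
    (Fintype.card a * Fintype.card b : ℂ) - 1 ≠ 0 ∧ (Fintype.card a * Fintype.card b : ℂ) + 1 ≠ 0 ∧
    (Fintype.card a * Fintype.card b : ℂ) - 2 ≠ 0 ∧
    (Fintype.card a * Fintype.card b : ℂ) + 2 ≠ 0 := by
  have h : 4 ≤ Fintype.card a * Fintype.card b := Nat.mul_le_mul ha hb
  have h' : (4 : ℝ) ≤ (Fintype.card a * Fintype.card b : ℝ) := by exact_mod_cast h
  have key : ∀ t : ℝ, (Fintype.card a * Fintype.card b : ℝ) + t ≠ 0 →
      (Fintype.card a * Fintype.card b : ℂ) + t ≠ 0 := fun t ht => by exact_mod_cast ht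
  refine ⟨?_, ?_, ?_, ?_⟩
  · simpa [sub_eq_add_neg] using key (-1) (by linarith)
  · simpa using key 1 (by linarith)
  · simpa [sub_eq_add_neg] using key (-2) (by linarith)
  · simpa using key 2 (by linarith)

lemma exists_integral_marginalOverlap_eq (ha : 2 ≤ Fintype.card a) (hb : 2 ≤ Fintype.card b) :
    ∃ u v : ℂ, u + v = (coeff1 (Fintype.card a) (Fintype.card b) : ℝ) ∧
    ∀ r s p : a × b, ∫ U, marginalOverlap r s p U ∂μ =
      (coeff0 (Fintype.card a) (Fintype.card b) 0 : ℝ)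
      + (if r = p then u else 0) + (if s = p then v else 0)
      + (if r = s then ((coeff0 (Fintype.card a) (Fintype.card b) 1 -
          coeff0 (Fintype.card a) (Fintype.card b) 0 : ℝ) : ℂ) else 0)
      + (if r = s then if s = p then ((coeff2 (Fintype.card a) (Fintype.card b) : ℝ) : ℂ)
          else 0 else 0) := by
  obtain ⟨h1, h2, h3, h4⟩ := overlap_coefficients ha hb
  set x : ℂ := (Fintype.card a : ℂ) with hx
  set y : ℂ := (Fintype.card b : ℂ) with hy
  -- The five averages: `α` for `r = s = p`, `β` for `r = s ≠ p`, `γ` for `r = p ≠ s`, `δ` for `s =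
  -- p ≠ r`, and `ε` for three distinct columns. The last four solve the sum rules below.
  obtain ⟨α, hα⟩ : ∃ α : ℂ, α = (3 * (x * y) + x ^ 2 + y ^ 2 + 1) / ((x * y + 1) * (x * y + 2)) :=
    ⟨_, rfl⟩
  obtain ⟨β, hβ⟩ : ∃ β : ℂ, β = (1 - α) / (x * y - 1) := ⟨_, rfl⟩
  obtain ⟨γ, hγ⟩ : ∃ γ : ℂ, γ = (x * ((x + y) / (x * y + 1)) - α) / (x * y - 1) := ⟨_, rfl⟩
  obtain ⟨δ, hδ⟩ : ∃ δ : ℂ, δ = (y * ((x + y) / (x * y + 1)) - α) / (x * y - 1) := ⟨_, rfl⟩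
  obtain ⟨ε, hε⟩ : ∃ ε : ℂ, ε = (1 - γ - δ) / (x * y - 2) := ⟨_, rfl⟩
  have hcard : (Fintype.card (a × b) : ℂ) = x * y := by simp [hx, hy]
  have hD : ((x * y) ^ 2 - 1) * ((x * y) ^ 2 - 4) =
      (x * y - 1) * (x * y + 1) * ((x * y - 2) * (x * y + 2)) := by ring
  have hc0 : ((coeff0 (Fintype.card a) (Fintype.card b) 0 : ℝ) : ℂ) = ε := by
    simp only [coeff0]
    push_cast
    rw [← hx, ← hy, hD, hε, hγ, hδ, hα]
    field_simp
    ring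
  have hc01 : ((coeff0 (Fintype.card a) (Fintype.card b) 1 -
          coeff0 (Fintype.card a) (Fintype.card b) 0 : ℝ) : ℂ) = β - ε := by
    rw [← hc0]
    simp only [coeff0]
    push_cast
    rw [← hx, ← hy, hD, hβ, hα]
    field_simp
    ring
  have hc1 : ((coeff1 (Fintype.card a) (Fintype.card b) : ℝ) : ℂ) = γ + δ - 2 * ε := by
    rw [← hc0]
    simp only [coeff0, coeff1]
    push_cast
    rw [← hx, ← hy, hD, hγ, hδ, hα]
    field_simp
    ring
  have hc2 : ((coeff2 (Fintype.card a) (Fintype.card b) : ℝ) : ℂ) = α - β - γ - δ + 2 * ε := by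
    rw [← hc0]
    simp only [coeff0, coeff2]
    push_cast
    rw [← hx, ← hy, hD, hβ, hγ, hδ, hα]
    field_simp
    ring
  have e3 : ∀ r : a × b, ∫ U, marginalOverlap r r r U ∂μ = α := fun r => by
    rw [integral_marginalOverlap_self, hα]
  have e12 : ∀ r p : a × b, r ≠ p → ∫ U, marginalOverlap r r p U ∂μ = β := fun r p h => by
    have := sum_integral_marginalOverlap μ r r
    rw [sum_eq_add_card_sub_one_mul (r := r) (k := p) fun q hq =>
      integral_marginalOverlap_congr_third μ r r hq.symm hq.symm h h, e3, hcard] at this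
    rw [hβ, eq_div_iff h1]
    linear_combination this
  have e13 : ∀ r s : a × b, r ≠ s → ∫ U, marginalOverlap r s r U ∂μ = γ := fun r s h => by
    have := sum_integral_marginalOverlap_snd μ r
    rw [sum_eq_add_card_sub_one_mul (r := r) (k := s) fun q hq =>
      integral_marginalOverlap_congr_second μ r r hq.symm hq.symm h h, e3, hcard] at this
    rw [hγ, eq_div_iff h1]
    linear_combination this
  have e23 : ∀ s r : a × b, s ≠ r → ∫ U, marginalOverlap r s s U ∂μ = δ := fun s r h => by
    have := sum_integral_marginalOverlap_fst μ s
    rw [sum_eq_add_card_sub_one_mul (r := s) (k := r) fun q hq =>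
      integral_marginalOverlap_congr_first μ s s hq.symm hq.symm h h, e3, hcard] at this
    rw [hδ, eq_div_iff h1]
    linear_combination this
  -- For `r ≠ s` the sum over `p` is `γ + δ + (d - 2) ε = 1`.
  have e0 : ∀ r s p : a × b, r ≠ s → r ≠ p → s ≠ p → ∫ U, marginalOverlap r s p U ∂μ = ε := by
    intro r s p hrs hrp hsp
    have := sum_integral_marginalOverlap μ r s
    rw [← Finset.add_sum_erase _ _ (Finset.mem_univ r),
      ← Finset.add_sum_erase _ _ (Finset.mem_erase.mpr ⟨hrs.symm, Finset.mem_univ s⟩),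
      Finset.sum_congr rfl fun q hq => integral_marginalOverlap_congr_third μ r s (q := p)
        (Finset.ne_of_mem_erase (Finset.mem_of_mem_erase hq)).symm
        (Finset.ne_of_mem_erase hq).symm hrp hsp, Finset.sum_const,
      Finset.card_erase_of_mem (Finset.mem_erase.mpr ⟨hrs.symm, Finset.mem_univ s⟩),
      Finset.card_erase_of_mem (Finset.mem_univ r), Finset.card_univ, nsmul_eq_mul,
      e13 r s hrs, e23 s r hrs.symm, Nat.sub_sub, Nat.cast_sub, hcard] at this
    · push_cast at this
      rw [hε, eq_div_iff h3]
      linear_combination this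
    · exact Fintype.one_lt_card_iff.mpr ⟨r, s, hrs⟩
  -- Inclusion-exclusion over the coincidence patterns. Only the sum of these two numbers enters
  -- `σ`: since the eigenvalues add up to one, both indicators produce a multiple of `x p`.
  refine ⟨γ - ε, δ - ε, by rw [hc1]; ring, fun r s p => ?_⟩
  rw [hc0, hc01, hc2]
  by_cases hrs : r = s
  · subst hrs
    by_cases hrp : r = p
    · subst hrp
      simp only [if_true, e3]
      ring
    · simp only [if_true, hrp, if_false, e12 r p hrp]
      ring
  · by_cases hrp : r = p
    · subst hrp
      simp only [if_true, hrs, Ne.symm hrs, if_false, e13 r s hrs]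
      ring
    · by_cases hsp : s = p
      · subst hsp
        simp only [if_true, hrs, if_false, e23 s r (Ne.symm hrs)]
        ring
      · simp only [hrs, hrp, hsp, if_false, e0 r s p hrs hrp hsp]
        ring

/-- The eigenvalue of `σ` on the eigenvector of `ρ` with eigenvalue `t`, for `ρ` of purity `q`. -/
noncomputable def sigmaEigenvalue (dA dB q t : ℝ) : ℝ :=
  coeff0 dA dB q + coeff1 dA dB * t + coeff2 dA dB * t ^ 2

/-- The average over the unitary orbit of a function of the state against the product of the
marginals: `∫ Tr (g(ρ') (ρ'_A ⊗ ρ'_B)) dμ = Tr (g(ρ) σ)`. -/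
lemma integral_re_trace_mul_kronecker (ha : 2 ≤ Fintype.card a) (hb : 2 ≤ Fintype.card b)
    (V : unitaryGroup (a × b) ℂ) {x : a × b → ℝ} (hx : ∑ i, x i = 1) (g : a × b → ℝ) :
    ∫ U, (spectralMatrix (U * V) g * (reducedA (spectralMatrix (U * V) x) ⊗ₖ
      reducedB (spectralMatrix (U * V) x))).trace.re ∂μ =
    ∑ p, g p * sigmaEigenvalue (Fintype.card a) (Fintype.card b) (∑ i, x i ^ 2) (x p) := by
  unfold sigmaEigenvalue
  have := isMulRightInvariant_haar μ
  rw [integral_mul_right_eq_self (μ := μ) (fun W => (spectralMatrix W g * (reducedA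
    (spectralMatrix W x) ⊗ₖ reducedB (spectralMatrix W x))).trace.re) V]
  simp only [trace_spectralMatrix_mul_kronecker]
  have hint : Integrable (fun U : unitaryGroup (a × b) ℂ => ∑ p, ∑ r, ∑ s,
      (g p * x r * x s : ℂ) * marginalOverlap r s p U) μ :=
    integrable_haar_of_continuous μ (by fun_prop)
  have hre := integral_re hint
  simp only [RCLike.re_to_complex] at hre
  rw [hre]
  simp (disch := intros; fun_prop) only [integral_sum_haar, integral_const_mul]
  obtain ⟨u, v, huv, h⟩ := exists_integral_marginalOverlap_eq μ ha hb
  have hx' : ∑ i, (x i : ℂ) = 1 := by exact_mod_cast hx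
  simp only [h]
  rw [Complex.re_sum]
  refine Finset.sum_congr rfl fun p _ => ?_
  rw [← Complex.ofReal_re (g p * _)]
  congr 1
  -- `c₀` is affine in the purity; its slope is the weight of the pattern `r = s`, whose sum
  -- produces `∑ x r ^ 2`.
  have e0 : coeff0 (Fintype.card a) (Fintype.card b) (∑ i, x i ^ 2) =
      coeff0 (Fintype.card a) (Fintype.card b) 0 + (coeff0 (Fintype.card a) (Fintype.card b) 1 -
        coeff0 (Fintype.card a) (Fintype.card b) 0) * ∑ i, x i ^ 2 := by
    simp only [coeff0]
    ring
  rw [e0]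
  push_cast
  rw [← huv]
  simp only [mul_add, Finset.sum_add_distrib, mul_ite, mul_zero, Finset.sum_ite_irrel,
    Finset.sum_ite_eq, Finset.sum_ite_eq', Finset.mem_univ, if_true, Finset.sum_const_zero]
  have s1 : ∀ c : ℂ, ∑ r, ∑ s, (g p * x r * x s * c : ℂ) = g p * c := by
    intro c
    have : ∀ r s, (g p * x r * x s * c : ℂ) = g p * c * (x r * x s) := fun r s => by ring
    simp only [this, ← Finset.mul_sum, hx', mul_one]
  have s2 : ∀ c : ℂ, ∑ s, (g p * x p * x s * c : ℂ) = g p * (c * x p) := by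
    intro c
    have : ∀ s, (g p * x p * x s * c : ℂ) = g p * (c * x p) * x s := fun s => by ring
    simp only [this, ← Finset.mul_sum, hx', mul_one]
  have s3 : ∀ c : ℂ, ∑ r, (g p * x r * x p * c : ℂ) = g p * (c * x p) := by
    intro c
    have : ∀ r, (g p * x r * x p * c : ℂ) = g p * (c * x p) * x r := fun s => by ring
    simp only [this, ← Finset.mul_sum, hx', mul_one]
  have s4 : ∀ c : ℂ, ∑ r, (g p * x r * x r * c : ℂ) = g p * (c * ∑ r, (x r : ℂ) ^ 2) := by
    intro c
    have : ∀ r, (g p * x r * x r * c : ℂ) = g p * c * (x r : ℂ) ^ 2 := fun s => by ring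
    simp only [this, ← Finset.mul_sum]
    ring
  simp only [s1, s2, s3, s4]
  ring

end Overlap

/-! ### Spectrum and fixed points of `σ`, and the averaged inequalities -/

section MainTheorem

variable {a b : Type*} [Fintype a] [DecidableEq a] [Fintype b] [DecidableEq b]

lemma sigmaState_spectralMatrix (V : unitaryGroup (a × b) ℂ) (x : a × b → ℝ) :
    sigmaState (spectralMatrix V x) = spectralMatrix V (fun i =>
      sigmaEigenvalue (Fintype.card a) (Fintype.card b) (∑ i, x i ^ 2) (x i)) := by
  have hsq : spectralMatrix V x ^ 2 = spectralMatrix V (fun i => x i ^ 2) := by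
    rw [pow_two, spectralMatrix_mul]
    simp only [pow_two]
  rw [sigmaState, hsq, trace_spectralMatrix, Complex.ofReal_re, ← spectralMatrix_one V,
    spectralMatrix_smul, spectralMatrix_smul, spectralMatrix_smul, spectralMatrix_add,
    spectralMatrix_add]
  simp only [mul_one, sigmaEigenvalue]

lemma sigma_denominators_pos {x y : ℝ} (hx : 2 ≤ x) (hy : 2 ≤ y) :
    4 ≤ x * y ∧ 0 < (x * y) ^ 2 - 1 ∧ 0 < (x * y) ^ 2 - 4 ∧ 0 < x ^ 2 - 1 ∧ 0 < y ^ 2 - 1 := by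
  have h : 4 ≤ x * y := by nlinarith
  exact ⟨h, by nlinarith, by nlinarith, by nlinarith, by nlinarith⟩

lemma coeff2_pos {x y : ℝ} (hx : 2 ≤ x) (hy : 2 ≤ y) : 0 < coeff2 x y := by
  obtain ⟨h, h1, h2, h3, h4⟩ := sigma_denominators_pos hx hy
  have : 0 < x * y := by linarith
  unfold coeff2
  positivity

lemma sigmaEigenvalue_pos {x y q t : ℝ} (hx : 2 ≤ x) (hy : 2 ≤ y) (hq : q ≤ 1) (ht : 0 ≤ t) :
    0 < sigmaEigenvalue x y q t := by
  obtain ⟨h, h1, h2, h3, h4⟩ := sigma_denominators_pos hx hy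
  have hc0 : 0 < coeff0 x y q := by
    have : 0 < x * y - 2 * q := by linarith
    unfold coeff0
    positivity
  have hc1 : 0 ≤ coeff1 x y := by
    -- Dimensions at least two give `x² + y² ≥ 8`.
    have : 0 ≤ x ^ 2 + y ^ 2 - 6 := by nlinarith
    unfold coeff1
    positivity
  have hc2 := (coeff2_pos hx hy).le
  unfold sigmaEigenvalue
  positivity

/-- With `d = d_A d_B`, the fixed-point equation of an eigenvalue is
`t² - (d/2) t + 1/2 - q/d = 0`. -/
lemma sigmaEigenvalue_sub {x y : ℝ} (hx : 2 ≤ x) (hy : 2 ≤ y) (q t : ℝ) :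
    sigmaEigenvalue x y q t - t =
      coeff2 x y * (t ^ 2 - x * y / 2 * t + 1 / 2 - q / (x * y)) := by
  obtain ⟨h, h1, h2, h3, h4⟩ := sigma_denominators_pos hx hy
  have hd : x * y ≠ 0 := by linarith
  have hx0 : x ≠ 0 := by linarith
  have hy0 : y ≠ 0 := by linarith
  have hD : ((x * y) ^ 2 - 1) * ((x * y) ^ 2 - 4) ≠ 0 := (mul_pos h1 h2).ne'
  unfold sigmaEigenvalue coeff0 coeff1 coeff2
  generalize hE : ((x * y) ^ 2 - 1) * ((x * y) ^ 2 - 4) = E at hD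
  field_simp
  rw [← hE]
  ring

-- Summed over the `d` eigenvalues, the quadratic of `sigmaEigenvalue_sub` is `q - d/2 + d/2 - q =
-- 0`, so `σ` keeps trace one.
omit [DecidableEq a] [DecidableEq b] in
lemma sum_sigmaEigenvalue {x : a × b → ℝ} (ha : 2 ≤ Fintype.card a) (hb : 2 ≤ Fintype.card b)
    (hx : ∑ i, x i = 1) :
    ∑ i, sigmaEigenvalue (Fintype.card a) (Fintype.card b) (∑ i, x i ^ 2) (x i) = 1 := by
  have ha' : (2 : ℝ) ≤ Fintype.card a := by exact_mod_cast ha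
  have hb' : (2 : ℝ) ≤ Fintype.card b := by exact_mod_cast hb
  have h : ∀ i, sigmaEigenvalue (Fintype.card a) (Fintype.card b) (∑ i, x i ^ 2) (x i) =
      x i + coeff2 (Fintype.card a) (Fintype.card b) * (x i ^ 2 -
        Fintype.card a * Fintype.card b / 2 * x i + (1 / 2 -
          (∑ i, x i ^ 2) / (Fintype.card a * Fintype.card b))) := fun i => by
    linear_combination sigmaEigenvalue_sub ha' hb' (∑ i, x i ^ 2) (x i)
  have hd : (Fintype.card a * Fintype.card b : ℝ) ≠ 0 := by
    have := (sigma_denominators_pos ha' hb').1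
    linarith
  simp only [h, Finset.sum_add_distrib, ← Finset.mul_sum, Finset.sum_sub_distrib, hx,
    Finset.sum_const, Finset.card_univ, Fintype.card_prod, nsmul_eq_mul, Nat.cast_mul]
  field_simp
  ring

lemma le_one_of_sum_eq_one {n : Type*} [Fintype n] {x : n → ℝ} (h0 : ∀ i, 0 ≤ x i)
    (h1 : ∑ i, x i = 1) : ∑ i, x i ^ 2 ≤ 1 := by
  rw [← h1]
  refine Finset.sum_le_sum fun i _ => ?_
  have : x i ≤ 1 := by
    rw [← h1]
    exact Finset.single_le_sum (fun j _ => h0 j) (Finset.mem_univ i)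
  nlinarith [h0 i]

/-- All eigenvalues solve one quadratic whose roots sum to `d / 2 ≥ 2`. Two different eigenvalues
would be both roots, yet two eigenvalues of a state sum to at most one. So the spectrum is constant.
-/
lemma eq_inv_card_of_sigmaEigenvalue_eq (ha : 2 ≤ Fintype.card a) (hb : 2 ≤ Fintype.card b)
    {x : a × b → ℝ} (h0 : ∀ i, 0 ≤ x i) (h1 : ∑ i, x i = 1)
    (h : ∀ i, sigmaEigenvalue (Fintype.card a) (Fintype.card b) (∑ i, x i ^ 2) (x i) = x i)
    (i : a × b) : x i = (Fintype.card a : ℝ)⁻¹ * (Fintype.card b : ℝ)⁻¹ := by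
  have ha' : (2 : ℝ) ≤ Fintype.card a := by exact_mod_cast ha
  have hb' : (2 : ℝ) ≤ Fintype.card b := by exact_mod_cast hb
  have hroot : ∀ j, x j ^ 2 - Fintype.card a * Fintype.card b / 2 * x j + 1 / 2 -
      (∑ i, x i ^ 2) / (Fintype.card a * Fintype.card b) = 0 := fun j => by
    have := sigmaEigenvalue_sub ha' hb' (∑ i, x i ^ 2) (x j)
    rw [h j, sub_self, eq_comm] at this
    exact (mul_eq_zero.mp this).resolve_left (coeff2_pos ha' hb').ne'
  have hd := (sigma_denominators_pos ha' hb').1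
  have hconst : ∀ j, x j = x i := fun j => by
    by_contra hne
    have h2 : (x j - x i) * (x j + x i - Fintype.card a * Fintype.card b / 2) = 0 := by
      linear_combination hroot j - hroot i
    have h3 := (mul_eq_zero.mp h2).resolve_left (sub_ne_zero.mpr hne)
    have h4 : x j + x i ≤ 1 := by
      rw [← h1, ← Finset.sum_pair (fun h => hne (congrArg x h))]
      exact Finset.sum_le_univ_sum_of_nonneg h0
    linarith
  simp only [hconst, Finset.sum_const, Finset.card_univ, Fintype.card_prod, nsmul_eq_mul,
    Nat.cast_mul] at h1
  rw [← mul_inv]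
  exact eq_inv_of_mul_eq_one_right h1

lemma maximallyMixed_eq_spectralMatrix (V : unitaryGroup (a × b) ℂ) :
    maximallyMixed a b =
      spectralMatrix V (fun _ => (Fintype.card a : ℝ)⁻¹ * (Fintype.card b : ℝ)⁻¹) := by
  have h : (fun _ : a × b => (Fintype.card a : ℝ)⁻¹ * (Fintype.card b : ℝ)⁻¹) =
      fun _ => ((Fintype.card a : ℝ)⁻¹ * (Fintype.card b : ℝ)⁻¹) * 1 := by simp
  rw [h, ← spectralMatrix_smul, spectralMatrix_one, maximallyMixed, smul_kronecker,
    kronecker_smul, smul_smul, one_kronecker_one]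

/-- The only density matrix with `ρ = σ` is the maximally mixed one. -/
lemma eq_sigmaState_iff (ha : 2 ≤ Fintype.card a) (hb : 2 ≤ Fintype.card b)
    {ρ : Matrix (a × b) (a × b) ℂ} (hρ : IsDensityMatrix ρ) :
    ρ = sigmaState ρ ↔ ρ = maximallyMixed a b := by
  obtain ⟨V, x, h0, h1, rfl⟩ := exists_spectralMatrix_of_isDensityMatrix hρ
  rw [sigmaState_spectralMatrix, maximallyMixed_eq_spectralMatrix V,
    (spectralMatrix_injective V).eq_iff, (spectralMatrix_injective V).eq_iff]
  constructor
  · intro h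
    funext i
    exact eq_inv_card_of_sigmaEigenvalue_eq ha hb h0 h1 (fun j => (congrFun h j).symm) i
  · intro h
    -- Conversely, a constant spectrum makes the spectrum of `σ` constant, and trace one fixes its
    -- value.
    have hsum := sum_sigmaEigenvalue ha hb h1
    have hd : (Fintype.card a * Fintype.card b : ℝ) ≠ 0 := by
      have : 0 < Fintype.card a * Fintype.card b := by positivity
      exact_mod_cast this.ne'
    have hx : ∀ j, x j = (Fintype.card a : ℝ)⁻¹ * (Fintype.card b : ℝ)⁻¹ := fun j => congrFun h j
    funext i
    have hs : ∀ j, sigmaEigenvalue (Fintype.card a) (Fintype.card b) (∑ i, x i ^ 2) (x j) =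
        sigmaEigenvalue (Fintype.card a) (Fintype.card b) (∑ i, x i ^ 2) (x i) := fun j => by
      rw [hx j, hx i]
    simp only [hs, Finset.sum_const, Finset.card_univ, Fintype.card_prod, nsmul_eq_mul,
      Nat.cast_mul] at hsum
    rw [hx i, ← mul_inv] at *
    exact (eq_inv_of_mul_eq_one_right hsum).symm

@[fun_prop]
lemma continuous_orbitState {n : Type*} [Fintype n] [DecidableEq n] (ρ : Matrix n n ℂ) :
    Continuous (orbitState ρ) := by
  have h : Continuous fun U : unitaryGroup n ℂ => (U : Matrix n n ℂ) := continuous_subtype_val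
  exact (h.matrix_mul continuous_const).matrix_mul h.matrix_conjTranspose

omit [Fintype a] [DecidableEq a] [DecidableEq b] in
lemma continuous_reducedA : Continuous (reducedA : Matrix (a × b) (a × b) ℂ → Matrix a a ℂ) := by
  refine continuous_matrix fun i k => continuous_finsetSum _ fun j _ => ?_
  exact continuous_apply_apply _ _

omit [DecidableEq a] [Fintype b] [DecidableEq b] in
lemma continuous_reducedB : Continuous (reducedB : Matrix (a × b) (a × b) ℂ → Matrix b b ℂ) := by
  refine continuous_matrix fun i k => continuous_finsetSum _ fun j _ => ?_
  exact continuous_apply_apply _ _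

lemma isDensityMatrix_orbitState {n : Type*} [Fintype n] [DecidableEq n] {ρ : Matrix n n ℂ}
    (hρ : IsDensityMatrix ρ) (U : unitaryGroup n ℂ) : IsDensityMatrix (orbitState ρ U) := by
  obtain ⟨V, x, h0, h1, rfl⟩ := exists_spectralMatrix_of_isDensityMatrix hρ
  rw [spectralMatrix_unitary_mul]
  exact isDensityMatrix_spectralMatrix h0 h1

lemma vnEntropy_orbitState {n : Type*} [Fintype n] [DecidableEq n] {ρ : Matrix n n ℂ}
    (hρ : IsDensityMatrix ρ) (U : unitaryGroup n ℂ) :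
    vnEntropy (orbitState ρ U) = vnEntropy ρ := by
  obtain ⟨V, x, h0, h1, rfl⟩ := exists_spectralMatrix_of_isDensityMatrix hρ
  rw [spectralMatrix_unitary_mul, vnEntropy_spectralMatrix, vnEntropy_spectralMatrix]

lemma mutualInfo_orbitState {ρ : Matrix (a × b) (a × b) ℂ} (hρ : IsDensityMatrix ρ)
    (U : unitaryGroup (a × b) ℂ) : mutualInfo (orbitState ρ U) =
      vnEntropy (reducedA (orbitState ρ U)) + vnEntropy (reducedB (orbitState ρ U)) -
        vnEntropy ρ := by
  rw [mutualInfo_eq (isDensityMatrix_orbitState hρ U).1, vnEntropy_orbitState hρ]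

variable [MeasurableSpace (unitaryGroup (a × b) ℂ)] [BorelSpace (unitaryGroup (a × b) ℂ)]
    (μ : Measure (unitaryGroup (a × b) ℂ)) [μ.IsHaarMeasure]

lemma integrable_vnEntropy_reducedA {ρ : Matrix (a × b) (a × b) ℂ} (hρ : IsDensityMatrix ρ) :
    Integrable (fun U => vnEntropy (reducedA (orbitState ρ U))) μ :=
  integrable_haar_of_continuous μ <| continuous_vnEntropy
    (continuous_reducedA.comp (continuous_orbitState ρ))
    fun U => isDensityMatrix_reducedA (isDensityMatrix_orbitState hρ U)

lemma integrable_vnEntropy_reducedB {ρ : Matrix (a × b) (a × b) ℂ} (hρ : IsDensityMatrix ρ) :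
    Integrable (fun U => vnEntropy (reducedB (orbitState ρ U))) μ :=
  integrable_haar_of_continuous μ <| continuous_vnEntropy
    (continuous_reducedB.comp (continuous_orbitState ρ))
    fun U => isDensityMatrix_reducedB (isDensityMatrix_orbitState hρ U)

lemma integrable_re_trace_mul_kronecker (V : unitaryGroup (a × b) ℂ) (x g : a × b → ℝ) :
    Integrable (fun U => (spectralMatrix (U * V) g * (reducedA (spectralMatrix (U * V) x) ⊗ₖ
      reducedB (spectralMatrix (U * V) x))).trace.re) μ := by
  refine integrable_haar_of_continuous μ ?_
  simp only [trace_spectralMatrix_mul_kronecker]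
  fun_prop

variable [IsProbabilityMeasure μ]

/-- Averaging Klein's inequality over the orbit bounds the mean entropies by the entropy of `σ`. -/
lemma integral_vnEntropy_add_le (ha : 2 ≤ Fintype.card a) (hb : 2 ≤ Fintype.card b)
    {ρ : Matrix (a × b) (a × b) ℂ} (hρ : IsDensityMatrix ρ) :
    (∫ U, vnEntropy (reducedA (orbitState ρ U)) ∂μ) +
      (∫ U, vnEntropy (reducedB (orbitState ρ U)) ∂μ) ≤ vnEntropy (sigmaState ρ) := by
  have hiA := integrable_vnEntropy_reducedA μ hρ
  have hiB := integrable_vnEntropy_reducedB μ hρ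
  have hρU := isDensityMatrix_orbitState hρ
  rw [← integral_add hiA hiB]
  obtain ⟨V, x, h0, h1, rfl⟩ := exists_spectralMatrix_of_isDensityMatrix hρ
  have ha' : (2 : ℝ) ≤ Fintype.card a := by exact_mod_cast ha
  have hb' : (2 : ℝ) ≤ Fintype.card b := by exact_mod_cast hb
  have hs0 := fun i =>
    sigmaEigenvalue_pos ha' hb' (le_one_of_sum_eq_one h0 h1) (h0 i)
  have hs1 := sum_sigmaEigenvalue ha hb h1
  have havg := integral_re_trace_mul_kronecker μ ha hb V h1
  rw [sigmaState_spectralMatrix, vnEntropy_spectralMatrix]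
  set s : a × b → ℝ := fun i =>
    sigmaEigenvalue (Fintype.card a) (Fintype.card b) (∑ i, x i ^ 2) (x i) with hs
  have hint := integrable_re_trace_mul_kronecker μ V x (fun i => Real.log (s i))
  calc ∫ U, (vnEntropy (reducedA (orbitState (spectralMatrix V x) U)) +
        vnEntropy (reducedB (orbitState (spectralMatrix V x) U))) ∂μ
      ≤ ∫ U, -(spectralMatrix (U * V) (fun i => Real.log (s i)) * (reducedA
          (spectralMatrix (U * V) x) ⊗ₖ reducedB (spectralMatrix (U * V) x))).trace.re ∂μ := by
        refine integral_mono (hiA.add hiB) hint.neg fun U => ?_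
        have hA := isDensityMatrix_reducedA (hρU U)
        have hB := isDensityMatrix_reducedB (hρU U)
        have hK := isDensityMatrix_kronecker hA hB
        change vnEntropy _ + vnEntropy _ ≤ _
        rw [← vnEntropy_kronecker hA hB, ← spectralMatrix_unitary_mul U V x]
        obtain ⟨W, y, hy0, hy1, hW⟩ := exists_spectralMatrix_of_isDensityMatrix hK
        rw [hW, ← matLog_spectralMatrix, trace_mul_comm]
        -- The comparison state has eigenbasis `U * V` and spectrum `s`, so it is `U σ U†`.
        exact vnEntropy_le_neg_trace_mul_log W (U * V) hy0 hy1 hs0 hs1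
    _ = -∑ i, s i * Real.log (s i) := by
        rw [integral_neg, havg]
        simp only [hs, mul_comm]

/-- Averaging the tangent-line bound for the logarithm over the orbit. -/
lemma le_integral_vnEntropy_add (ha : 2 ≤ Fintype.card a) (hb : 2 ≤ Fintype.card b)
    {ρ : Matrix (a × b) (a × b) ℂ} (hρ : IsDensityMatrix ρ) :
    vnEntropy ρ + relEntropy ρ (sigmaState ρ) ≤
      (∫ U, vnEntropy (reducedA (orbitState ρ U)) ∂μ) +
        (∫ U, vnEntropy (reducedB (orbitState ρ U)) ∂μ) := by
  have hiA := integrable_vnEntropy_reducedA μ hρ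
  have hiB := integrable_vnEntropy_reducedB μ hρ
  have hρU := isDensityMatrix_orbitState hρ
  rw [← integral_add hiA hiB]
  obtain ⟨V, x, h0, h1, rfl⟩ := exists_spectralMatrix_of_isDensityMatrix hρ
  have ha' : (2 : ℝ) ≤ Fintype.card a := by exact_mod_cast ha
  have hb' : (2 : ℝ) ≤ Fintype.card b := by exact_mod_cast hb
  have hs0 := fun i =>
    sigmaEigenvalue_pos ha' hb' (le_one_of_sum_eq_one h0 h1) (h0 i)
  have havg := integral_re_trace_mul_kronecker μ ha hb V h1
  rw [relEntropy_eq, sigmaState_spectralMatrix, matLog_spectralMatrix, spectralMatrix_mul,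
    trace_spectralMatrix, Complex.ofReal_re]
  set s : a × b → ℝ := fun i =>
    sigmaEigenvalue (Fintype.card a) (Fintype.card b) (∑ i, x i ^ 2) (x i) with hs
  -- The slope `x / s` is `ρ σ⁻¹`; its average against the marginals is `∑ x = 1`, cancelling the
  -- constant of the tangent line.
  have hint := integrable_re_trace_mul_kronecker μ V x (fun i => x i / s i)
  calc vnEntropy (spectralMatrix V x) + (-vnEntropy (spectralMatrix V x) -
        ∑ i, x i * Real.log (s i))
      = ∫ U, ((1 - ∑ i, x i * Real.log (s i)) - (spectralMatrix (U * V) (fun i => x i / s i) *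
          (reducedA (spectralMatrix (U * V) x) ⊗ₖ
            reducedB (spectralMatrix (U * V) x))).trace.re) ∂μ := by
        rw [integral_sub (integrable_const _) hint, havg, integral_const]
        have : ∀ i, x i / s i * sigmaEigenvalue (Fintype.card a) (Fintype.card b)
            (∑ i, x i ^ 2) (x i) = x i := fun i => div_mul_cancel₀ _ (hs0 i).ne'
        simp only [this, h1]
        simp
        ring
    _ ≤ _ := by
        refine integral_mono ((integrable_const _).sub hint) (hiA.add hiB) fun U => ?_
        change _ ≤ vnEntropy _ + vnEntropy _
        have hle := supportLE_reducedA_kronecker_reducedB (hρU U).1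
        have hlog := trace_mul_matLog_reducedA_kronecker_reducedB (hρU U).1
        have hK := isDensityMatrix_kronecker (isDensityMatrix_reducedA (hρU U))
          (isDensityMatrix_reducedB (hρU U))
        rw [spectralMatrix_unitary_mul] at hle hlog hK ⊢
        have := trace_mul_log_le (U * V) h0 hs0 hK.1 hle
        rw [hlog, h1] at this
        change _ - (spectralMatrix (U * V) (fun i => x i / s i) * _).trace.re ≤ _
        linarith

end MainTheorem

theorem theorem2 {a b : Type*} [Fintype a] [DecidableEq a] [Fintype b] [DecidableEq b]
    (ha : 2 ≤ Fintype.card a) (hb : 2 ≤ Fintype.card b)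
    [MeasurableSpace (unitaryGroup (a × b) ℂ)] [BorelSpace (unitaryGroup (a × b) ℂ)]
    (μ : Measure (unitaryGroup (a × b) ℂ)) [μ.IsHaarMeasure] [IsProbabilityMeasure μ]
    (ρ : Matrix (a × b) (a × b) ℂ) (hρ : IsDensityMatrix ρ) :
    -- all logarithms, relative entropies and integrals below are well defined and finite
    ((sigmaState ρ).PosDef ∧
      (∀ U : unitaryGroup (a × b) ℂ, SupportLE (orbitState ρ U)
        (reducedA (orbitState ρ U) ⊗ₖ reducedB (orbitState ρ U))) ∧
      Integrable (fun U => vnEntropy (reducedA (orbitState ρ U))) μ ∧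
      Integrable (fun U => vnEntropy (reducedB (orbitState ρ U))) μ ∧
      Integrable (fun U => mutualInfo (orbitState ρ U)) μ) ∧
    -- bounds on the average sum of the marginal entropies
    (vnEntropy ρ + relEntropy ρ (sigmaState ρ) ≤
        (∫ U, vnEntropy (reducedA (orbitState ρ U)) ∂μ) +
          (∫ U, vnEntropy (reducedB (orbitState ρ U)) ∂μ) ∧
      (∫ U, vnEntropy (reducedA (orbitState ρ U)) ∂μ) +
          (∫ U, vnEntropy (reducedB (orbitState ρ U)) ∂μ) ≤ vnEntropy (sigmaState ρ)) ∧
    -- bounds on the average mutual information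
    (relEntropy ρ (sigmaState ρ) ≤ (∫ U, mutualInfo (orbitState ρ U) ∂μ) ∧
      (∫ U, mutualInfo (orbitState ρ U) ∂μ) ≤ vnEntropy (sigmaState ρ) - vnEntropy ρ) ∧
    -- the universal entropy inequality
    relEntropy ρ (sigmaState ρ) ≤ vnEntropy (sigmaState ρ) - vnEntropy ρ ∧
    -- the fixed points
    (ρ = sigmaState ρ ↔ ρ = maximallyMixed a b) := by
  have hU := isDensityMatrix_orbitState hρ
  have hiA := integrable_vnEntropy_reducedA μ hρ
  have hiB := integrable_vnEntropy_reducedB μ hρ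
  have hlow := le_integral_vnEntropy_add μ ha hb hρ
  have hupp := integral_vnEntropy_add_le μ ha hb hρ
  have hmut : ∫ U, mutualInfo (orbitState ρ U) ∂μ =
      (∫ U, vnEntropy (reducedA (orbitState ρ U)) ∂μ) +
        (∫ U, vnEntropy (reducedB (orbitState ρ U)) ∂μ) - vnEntropy ρ := by
    simp only [mutualInfo_orbitState hρ]
    refine (integral_sub (hiA.add hiB) (integrable_const _)).trans ?_
    rw [integral_add' hiA hiB]
    simp
  -- The inequality free of averages comes from chaining the lower and upper bounds.
  refine ⟨⟨?_, fun U => supportLE_reducedA_kronecker_reducedB (hU U).1, hiA, hiB, ?_⟩,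
    ⟨hlow, hupp⟩, ⟨by linarith, by linarith⟩, by linarith, eq_sigmaState_iff ha hb hρ⟩
  · obtain ⟨V, x, h0, h1, rfl⟩ := exists_spectralMatrix_of_isDensityMatrix hρ
    rw [sigmaState_spectralMatrix]
    exact spectralMatrix_posDef fun i => sigmaEigenvalue_pos (by exact_mod_cast ha)
      (by exact_mod_cast hb) (le_one_of_sum_eq_one h0 h1) (h0 i)
  · simp only [mutualInfo_orbitState hρ]
    exact (hiA.add hiB).sub (integrable_const _)
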